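/- Let $d\ge 1$, $\mathbb T^d=\mathbb R^d/2\pi\mathbb Z^d$, $0<p\le\infty$, and let $\alpha\in\{1,2,3,\dots\}\cup((1/p-1)_+,\infty)$, where $1/\infty=0$ and $a_+=\max(a,0)$. Write $\|\cdot\|_p$ for the (quasi-)norm of the space $L_p(\mathbb T^d)$ of complex-valued functions with respect to Lebesgue measure, $|\cdot|$ for the Euclidean norm on $\mathbb R^d$, and $[a]$ for the integer part of $a$. For $f\in L_p(\mathbb T^d)$ and $\delta>0$ put $$\omega_\alpha(f,\delta)_p=\sup_{h\in\mathbb R^d,\,|h|\le\delta}\|\Delta_h^\alpha f\|_p,\qquad \Delta_h^\alpha f(x)=\sum_{\nu=0}^\infty(-1)^\nu\binom{\alpha}{\nu}f(x+(\alpha-\nu)h),\qquad \binom{\alpha}{\nu}=\frac{\alpha(\alpha-1)\cdots(\alpha-\nu+1)}{\nu!}.$$ Let $\mathcal T_n$ be the complex linear span of the functions $e^{i(k,x)}$, $k\in\mathbb Z^d$, $\max_j|k_j|\le n$, and let $E_n(f)_p=\inf_{T\in\mathcal T_n}\|f-T\|_p$. For $T(x)=\sum_k c_ke^{i(k,x)}$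 in some $\mathcal T_n$ and $\xi\in\mathbb R^d$ put $$\Big(\frac{\partial}{\partial\xi}\Big)^\alpha T(x)=\sum_k(i(k,\xi))^\alpha c_ke^{i(k,x)},$$ where $(it)^\alpha=|t|^\alpha e^{i\alpha\pi\,\mathrm{sgn}(t)/2}$ for real $t\neq0$ and $0^\alpha=0$. For $f\in L_p(\mathbb T^d)$, $\delta>0$ and a trigonometric polynomial $T$ put $$R(f,\delta,T)=\|f-T\|_p+\delta^\alpha\sup_{\xi\in\mathbb R^d,\,|\xi|=1}\Big\|\Big(\frac{\partial}{\partial\xi}\Big)^\alpha T\Big\|_p,\qquad \mathcal R_\alpha(f,\delta)_p=\inf_{T\in\mathcal T_{[1/\delta]}}R(f,\delta,T).$$ **Theorem 4.1.** (a) There is a constant $C>0$ depending only on $d$, $p$ and $\alpha$ such that for all $f\in L_p(\mathbb T^d)$ and all $\delta\in(0,1)$ $$C^{-1}\,\mathcal R_\alpha(f,\delta)_p\le\omega_\alpha(f,\delta)_p\le C\,\mathcal R_\alpha(f,\delta)_p .$$ (b) For every $K\ge0$ there is a constant $C>0$ depending only on $d$, $p$, $\alpha$ and $K$ such that for all $f\in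 L_p(\mathbb T^d)$, all $\delta\in(0,1)$ and all $T\in\mathcal T_n$, $n=[1/\delta]$, with $\|f-T\|_p\le K\,E_n(f)_p$, $$C^{-1}\,R(f,\delta,T)\le\omega_\alpha(f,\delta)_p\le C\,R(f,\delta,T).$$ -/

import Mathlib

open MeasureTheory
open scoped ENNReal NNReal

noncomputable section

namespace Realization

instance factTwoPiPos : Fact (0 < 2 * Real.pi) := ⟨Real.two_pi_pos⟩

/-- The torus `𝕋^d = ℝ^d / 2πℤ^d`. Its `volume` is the product of the Lebesgue measures of total
mass `2π` on the factors. The quasi-norm of `L_p(𝕋^d)` is `eLpNorm · p volume`. -/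
abbrev Torus (d : ℕ) : Type := Fin d → AddCircle (2 * Real.pi)

/-- The class in `𝕋^d` of a vector of `ℝ^d`. -/
def Torus.mk {d : ℕ} (v : EuclideanSpace ℝ (Fin d)) : Torus d :=
  fun j => ((v j : ℝ) : AddCircle (2 * Real.pi))

/-- The exponential `x ↦ e^{i(k,x)}` for `k ∈ ℤ^d`. -/
def expChar {d : ℕ} (k : Fin d → ℤ) (x : Torus d) : ℂ :=
  ∏ j, fourier (k j) (x j)

/-- `𝒯_n`, the complex linear span of the `e^{i(k,x)}` with `|k|_∞ ≤ n`. -/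
def trigPoly (d n : ℕ) : Submodule ℂ (Torus d → ℂ) :=
  Submodule.span ℂ (expChar '' {k : Fin d → ℤ | ∀ j, |k j| ≤ (n : ℤ)})

/-- The Fourier coefficient `(2π)^{-d} ∫_{𝕋^d} f(x) e^{-i(k,x)} dx`. -/
def fourierCoef {d : ℕ} (f : Torus d → ℂ) (k : Fin d → ℤ) : ℂ :=
  ((2 * Real.pi : ℝ) : ℂ)⁻¹ ^ d * ∫ x, f x * expChar (-k) x

/-- The directional (Weyl) derivative of order `α > 0` along `ξ`,
`∑_k (i(k,ξ))^α T̂_k e^{i(k,x)}`, with the principal branch of the power, so that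
`(it)^α = |t|^α e^{iαπ sgn(t)/2}` for real `t ≠ 0` and `0^α = 0`.
For a trigonometric polynomial, the only case used, the sum is finite. -/
def dirDeriv {d : ℕ} (α : ℝ) (ξ : EuclideanSpace ℝ (Fin d)) (T : Torus d → ℂ) (x : Torus d) : ℂ :=
  ∑' k : Fin d → ℤ,
    (Complex.I * ((∑ j, (k j : ℝ) * ξ j : ℝ) : ℂ)) ^ (α : ℂ) * fourierCoef T k * expChar k x

/-- The generalized binomial coefficient `α(α-1)⋯(α-ν+1)/ν!`. -/
def binom (α : ℝ) (ν : ℕ) : ℝ :=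
  (∏ j ∈ Finset.range ν, (α - j)) / (ν.factorial : ℝ)

/-- The difference of fractional order `Δ_h^α f(x) = ∑_{ν ≥ 0} (-1)^ν binom(α,ν) f(x + (α-ν)h)`.
For `f ∈ L_p` and `α` admissible for `p` (see below) the series converges absolutely at almost
every `x`, because `∑_ν |binom(α,ν)|^{min(1,p)} < ∞`; for `α ∈ ℕ` it is a finite sum. -/
def fracDiff {d : ℕ} (α : ℝ) (h : EuclideanSpace ℝ (Fin d)) (f : Torus d → ℂ) (x : Torus d) : ℂ :=
  ∑' ν : ℕ, (((-1) ^ ν * binom α ν : ℝ) : ℂ) * f (x + Torus.mk ((α - ν) • h))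

/-- `α ∈ ℕ ∪ ((1/p - 1)_+, ∞)`, where `ℕ = {1, 2, …}` and `1/∞ = 0`. -/
def Admissible (p : ℝ≥0∞) (α : ℝ) : Prop :=
  (∃ r : ℕ, 1 ≤ r ∧ α = r) ∨ max (p⁻¹.toReal - 1) 0 < α

/-- The modulus of smoothness `ω_α(f,δ)_p = sup_{|h| ≤ δ} ‖Δ_h^α f‖_p`. -/
def modulus {d : ℕ} (p : ℝ≥0∞) (α : ℝ) (f : Torus d → ℂ) (δ : ℝ) : ℝ≥0∞ :=
  ⨆ (h : EuclideanSpace ℝ (Fin d)) (_ : ‖h‖ ≤ δ), eLpNorm (fracDiff α h f) p volume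

/-- The error of best approximation `E_n(f)_p = inf_{T ∈ 𝒯_n} ‖f - T‖_p`. -/
def bestApprox {d : ℕ} (p : ℝ≥0∞) (n : ℕ) (f : Torus d → ℂ) : ℝ≥0∞ :=
  ⨅ T ∈ trigPoly d n, eLpNorm (f - T) p volume

/-- `‖f - T‖_p + δ^α sup_{|ξ| = 1} ‖(∂/∂ξ)^α T‖_p`. -/
def realizationTerm {d : ℕ} (p : ℝ≥0∞) (α : ℝ) (f : Torus d → ℂ) (δ : ℝ) (T : Torus d → ℂ) :
    ℝ≥0∞ :=
  eLpNorm (f - T) p volume + ENNReal.ofReal (δ ^ α) *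
    ⨆ (ξ : EuclideanSpace ℝ (Fin d)) (_ : ‖ξ‖ = 1), eLpNorm (dirDeriv α ξ T) p volume

/-- The realization `ℛ_α(f,δ)_p`, the infimum of `realizationTerm` over `T ∈ 𝒯_{[1/δ]}`. -/
def realization {d : ℕ} (p : ℝ≥0∞) (α : ℝ) (f : Torus d → ℂ) (δ : ℝ) : ℝ≥0∞ :=
  ⨅ T ∈ trigPoly d ⌊1 / δ⌋₊, realizationTerm p α f δ T

end Realization

end

/-!
Everything rests on one estimate. Let `q = min(1, p)`. Then `‖·‖_p ^ q` is countably subadditive and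
translation invariant, so an operator `f ↦ ∑_i a_i f(· + y_i)` is bounded on `L_p` with constant
`∑_i |a_i| ^ q` (`quasi_tsum_translate_le`). All operators below are written in this form, with
coefficients in `ℓ_q`; no duality or Fourier multiplier theory is used, and all `p > 0` are treated
alike. The admissible orders are those for which the coefficients of `Δ_h^α` are in `ℓ_q`
(`Admissible.binomSum_ne_top`).

*Polynomials.* On trigonometric polynomials `Δ_h^α` has the multiplier `e^{iαt} (1 - e^{-it})^α`,
`t = (k, h)`. It is `(it)^α` times a function that is smooth and nonzero near `t = 0`. Cutting that
function and its reciprocal off, one obtains Fourier series with rapidly decreasing coefficients,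
that is, sums of translates. Hence `Δ_h^α T` and `(∂/∂h)^α T` have comparable norms for `T ∈ 𝒯_n`
and `|h| ≤ c/n` (`exists_fracDiff_dirDeriv_le`). The restriction on `h` is relaxed by doubling:
`1 - z² = (1 - z)(1 + z)` makes `Δ_{2h}^α T` a sum of translates of `Δ_h^α T`, with
coefficients `binom α ν` (`quasi_fracDiff_two_smul_le`).

*Jackson's inequality.* What remains is to find `T ∈ 𝒯_n` with `‖f - T‖_p` bounded by the modulus.
By Vandermonde's identity `Δ_h^r = Δ_h^{r-α} Δ_h^α`, so differences of a large integer order `r` are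
controlled by those of order `α` (`exists_axisBound`), and only these have to be considered.
An abstract Whitney inequality (`IsQuasi.exists_whitney`) shows that a map of a real variable with
values in a quasi-normed space, here `u ↦ f(· + u e_i)`, is close to its Lagrange interpolation
polynomial if its `r`-th differences are small. A rapidly decreasing band-limited kernel reproduces
polynomials from their values at the integers, so sampling along each coordinate on a grid of step
`2π/(16n)` approximates `f`. The sampled function is a trigonometric polynomial in the position
relative to the grid, with translates of `f` as coefficients. Averaging over the position of the
grid selects a good polynomial (`exists_jackson`).

Combined, for `T ∈ 𝒯_n` the modulus is at most a constant times the realization term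
(`exists_modulus_le`), while the latter is at most a constant times `‖f - T‖_p` plus the modulus
(`exists_realizationTerm_le`), and `‖f - T‖_p` is bounded by the modulus for the Jackson polynomial
and so for every near-best `T`.
-/

noncomputable section

namespace Realization

/-! ### The quasi-norm and sums of translates -/

/-- The exponent `min(1, p)`, for which `‖·‖_p` raised to this power is subadditive. -/
def subExp (p : ℝ≥0∞) : ℝ := (min 1 p).toReal

theorem subExp_pos {p : ℝ≥0∞} (hp : 0 < p) : 0 < subExp p :=
  ENNReal.toReal_pos (lt_min one_pos hp).ne'
    (ne_top_of_le_ne_top ENNReal.one_ne_top (min_le_left _ _))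

theorem subExp_le_one (p : ℝ≥0∞) : subExp p ≤ 1 := by
  simpa [subExp] using ENNReal.toReal_mono ENNReal.one_ne_top (min_le_left 1 p)

theorem subExp_of_one_le {p : ℝ≥0∞} (hp : 1 ≤ p) : subExp p = 1 := by
  simp [subExp, min_eq_left hp]

theorem subExp_of_le_one {p : ℝ≥0∞} (hp : p ≤ 1) : subExp p = p.toReal := by
  simp [subExp, min_eq_right hp]

theorem sum_rpow_le_sum_rpow {ι : Type*} {q : ℝ} (hq : 0 < q) (hq1 : q ≤ 1) (s : Finset ι)
    (a : ι → ℝ≥0∞) : (∑ i ∈ s, a i) ^ q ≤ ∑ i ∈ s, a i ^ q := by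
  classical
  induction s using Finset.induction_on with
  | empty => simp [hq]
  | insert i s hi ih =>
    rw [Finset.sum_insert hi, Finset.sum_insert hi]
    exact (ENNReal.rpow_add_le_add_rpow _ _ hq.le hq1).trans (by gcongr)

theorem tsum_rpow_le_tsum_rpow {ι : Type*} {q : ℝ} (hq : 0 < q) (hq1 : q ≤ 1)
    (a : ι → ℝ≥0∞) : (∑' i, a i) ^ q ≤ ∑' i, a i ^ q := by
  have h : Filter.Tendsto (fun s : Finset ι => (∑ i ∈ s, a i) ^ q) Filter.atTop
      (nhds ((∑' i, a i) ^ q)) :=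
    (ENNReal.continuous_rpow_const.tendsto _).comp ENNReal.summable.hasSum
  exact le_of_tendsto' h fun s =>
    (sum_rpow_le_sum_rpow hq hq1 s a).trans (ENNReal.sum_le_tsum s)

/-- Countable subadditivity of `‖·‖_p ^ min(1, p)` for nonnegative functions. -/
theorem eLpNorm_tsum_rpow_le {Ω ι : Type*} [MeasurableSpace Ω] [Countable ι] {μ : Measure Ω}
    {p : ℝ≥0∞} (hp : 0 < p) {G : ι → Ω → ℝ≥0∞} (hG : ∀ i, AEMeasurable (G i) μ) :
    eLpNorm (fun x => ∑' i, G i x) p μ ^ subExp p ≤ ∑' i, eLpNorm (G i) p μ ^ subExp p := by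
  rcases le_total p 1 with h1 | h1
  · have hpt : p ≠ ∞ := ne_top_of_le_ne_top ENNReal.one_ne_top h1
    have hp0 : 0 < p.toReal := ENNReal.toReal_pos hp.ne' hpt
    have key : ∀ F : Ω → ℝ≥0∞, eLpNorm F p μ ^ p.toReal = ∫⁻ x, F x ^ p.toReal ∂μ := fun F => by
      rw [eLpNorm_eq_lintegral_rpow_enorm_toReal hp.ne' hpt, ← ENNReal.rpow_mul,
        one_div_mul_cancel hp0.ne', ENNReal.rpow_one]
      simp
    rw [subExp_of_le_one h1]
    simp_rw [key]
    rw [← lintegral_tsum fun i => (hG i).pow_const _]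
    have h1' : p.toReal ≤ 1 := by simpa using ENNReal.toReal_mono ENNReal.one_ne_top h1
    exact lintegral_mono fun x => tsum_rpow_le_tsum_rpow hp0 h1' _
  · simp only [subExp_of_one_le h1, ENNReal.rpow_one]
    rcases eq_or_ne p ∞ with rfl | hpt
    · simp only [eLpNorm_exponent_top]
      refine eLpNormEssSup_le_of_ae_enorm_bound ?_
      have : ∀ i, ∀ᵐ x ∂μ, ‖G i x‖ₑ ≤ eLpNormEssSup (G i) μ := fun i =>
        enorm_ae_le_eLpNormEssSup _ _
      filter_upwards [ae_all_iff.2 this] with x hx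
      simpa using ENNReal.tsum_le_tsum hx
    · have hp0 : 0 < p.toReal := ENNReal.toReal_pos hp.ne' hpt
      have key : ∀ F : Ω → ℝ≥0∞, eLpNorm F p μ = (∫⁻ x, F x ^ p.toReal ∂μ) ^ (1 / p.toReal) :=
        fun F => by
          rw [eLpNorm_eq_lintegral_rpow_enorm_toReal hp.ne' hpt]
          simp
      have hfin : ∀ s : Finset ι, eLpNorm (fun x => ∑ i ∈ s, G i x) p μ ≤ ∑' i, eLpNorm (G i) p μ := by
        intro s
        have := eLpNorm_sum_le (s := s) (fun i _ => (hG i).aestronglyMeasurable) h1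
        refine le_trans (le_of_eq ?_) (this.trans (ENNReal.sum_le_tsum s))
        congr 1
        ext x
        simp
      have hlim : ∫⁻ x, (∑' i, G i x) ^ p.toReal ∂μ
          = ⨆ s : Finset ι, ∫⁻ x, (∑ i ∈ s, G i x) ^ p.toReal ∂μ := by
        rw [← lintegral_iSup_directed]
        · refine lintegral_congr fun x => ?_
          rw [ENNReal.tsum_eq_iSup_sum]
          exact (ENNReal.orderIsoRpow _ hp0).map_iSup _
        · intro s
          exact (Finset.aemeasurable_fun_sum s fun i _ => hG i).pow_const _
        · refine Monotone.directed_le fun s t hst x => ?_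
          exact ENNReal.rpow_le_rpow (Finset.sum_le_sum_of_subset hst) hp0.le
      rw [key, hlim, one_div, ENNReal.rpow_inv_le_iff hp0]
      refine iSup_le fun s => ?_
      rw [← ENNReal.rpow_inv_le_iff hp0, ← one_div, ← key]
      exact hfin s

variable {d : ℕ}

/-- The power `‖g‖_p ^ min(1, p)` of the quasi-norm, which is subadditive for all `p > 0`. -/
def quasi (p : ℝ≥0∞) (g : Torus d → ℂ) : ℝ≥0∞ := eLpNorm g p volume ^ subExp p

theorem quasi_congr_ae {p : ℝ≥0∞} {f g : Torus d → ℂ} (h : f =ᵐ[volume] g) :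
    quasi p f = quasi p g := by
  rw [quasi, quasi, eLpNorm_congr_ae h]

theorem quasi_tsum_le {ι : Type*} [Countable ι] {p : ℝ≥0∞} (hp : 0 < p) {g : ι → Torus d → ℂ}
    (hg : ∀ i, AEStronglyMeasurable (g i) volume) :
    quasi p (fun x => ∑' i, g i x) ≤ ∑' i, quasi p (g i) := by
  have h := eLpNorm_tsum_rpow_le (μ := (volume : Measure (Torus d))) hp
    (G := fun i x => ‖g i x‖ₑ) fun i => (hg i).enorm
  have h2 : ∀ i, eLpNorm (fun x => ‖g i x‖ₑ) p volume = eLpNorm (g i) p volume := fun i =>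
    eLpNorm_congr_enorm_ae (by simp)
  simp only [h2] at h
  refine le_trans ?_ h
  refine ENNReal.rpow_le_rpow (eLpNorm_mono_enorm fun x => ?_) (subExp_pos hp).le
  simpa using enorm_tsum_le_tsum_enorm

theorem quasi_sum_le {ι : Type*} {p : ℝ≥0∞} (hp : 0 < p) (s : Finset ι) {g : ι → Torus d → ℂ}
    (hg : ∀ i, AEStronglyMeasurable (g i) volume) :
    quasi p (fun x => ∑ i ∈ s, g i x) ≤ ∑ i ∈ s, quasi p (g i) := by
  have h := quasi_tsum_le hp (g := fun i : s => g i) fun i => hg i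
  simp only [tsum_fintype] at h
  rw [Finset.sum_coe_sort s fun i => quasi p (g i)] at h
  refine le_trans (le_of_eq ?_) h
  congr 1
  ext x
  exact (Finset.sum_coe_sort s fun i => g i x).symm

theorem quasi_add_le {p : ℝ≥0∞} (hp : 0 < p) {f g : Torus d → ℂ}
    (hf : AEStronglyMeasurable f volume) (hg : AEStronglyMeasurable g volume) :
    quasi p (f + g) ≤ quasi p f + quasi p g := by
  have h := quasi_sum_le hp (Finset.univ : Finset Bool) (g := fun b => cond b f g)
    (by rintro (_ | _) <;> assumption)
  simpa [Pi.add_def] using h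

theorem quasi_const_mul {p : ℝ≥0∞} (hp : 0 < p) (c : ℂ) (g : Torus d → ℂ) :
    quasi p (fun x => c * g x) = ‖c‖ₑ ^ subExp p * quasi p g := by
  have : (fun x => c * g x) = c • g := rfl
  rw [quasi, quasi, this, eLpNorm_const_smul, ENNReal.mul_rpow_of_nonneg _ _ (subExp_pos hp).le]

theorem quasi_neg {p : ℝ≥0∞} (g : Torus d → ℂ) : quasi p (-g) = quasi p g := by
  rw [quasi, quasi, eLpNorm_neg]

theorem quasi_sub_le {p : ℝ≥0∞} (hp : 0 < p) {f g : Torus d → ℂ}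
    (hf : AEStronglyMeasurable f volume) (hg : AEStronglyMeasurable g volume) :
    quasi p (f - g) ≤ quasi p f + quasi p g := by
  rw [sub_eq_add_neg, ← quasi_neg g]
  exact quasi_add_le hp hf hg.neg

theorem measurePreserving_translate (y : Torus d) :
    MeasurePreserving (fun x : Torus d => x + y) volume volume :=
  measurePreserving_add_right volume y

theorem aesm_translate {g : Torus d → ℂ} (hg : AEStronglyMeasurable g volume) (y : Torus d) :
    AEStronglyMeasurable (fun x => g (x + y)) volume :=
  hg.comp_measurePreserving (measurePreserving_translate y)

theorem quasi_translate {p : ℝ≥0∞} {g : Torus d → ℂ} (hg : AEStronglyMeasurable g volume)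
    (y : Torus d) : quasi p (fun x => g (x + y)) = quasi p g := by
  rw [quasi, quasi]
  congr 1
  exact eLpNorm_comp_measurePreserving hg (measurePreserving_translate y)

theorem quasi_tsum_translate_le {ι : Type*} [Countable ι] {p : ℝ≥0∞} (hp : 0 < p)
    {g : Torus d → ℂ} (hg : AEStronglyMeasurable g volume) (a : ι → ℂ) (y : ι → Torus d) :
    quasi p (fun x => ∑' i, a i * g (x + y i)) ≤ (∑' i, ‖a i‖ₑ ^ subExp p) * quasi p g := by
  refine (quasi_tsum_le hp fun i => (aesm_translate hg (y i)).const_mul (a i)).trans ?_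
  rw [← ENNReal.tsum_mul_right]
  refine ENNReal.tsum_le_tsum fun i => ?_
  rw [quasi_const_mul hp, quasi_translate hg]

/-- A series of translates of `g ∈ L_p` with coefficients in `ℓ_q`, `q = min(1, p)`, converges
absolutely almost everywhere. -/
theorem ae_summable_translate {ι : Type*} [Countable ι] {p : ℝ≥0∞} (hp : 0 < p)
    {g : Torus d → ℂ} (hg : MemLp g p volume) {a : ι → ℂ} (y : ι → Torus d)
    (ha : ∑' i, ‖a i‖ₑ ^ subExp p ≠ ∞) :
    ∀ᵐ x, Summable fun i => a i * g (x + y i) := by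
  have hm : ∀ i, AEStronglyMeasurable (fun x => a i * g (x + y i)) volume := fun i =>
    (aesm_translate hg.1 (y i)).const_mul (a i)
  have h := eLpNorm_tsum_rpow_le (μ := (volume : Measure (Torus d))) hp
    (G := fun i x => ‖a i * g (x + y i)‖ₑ) fun i => (hm i).enorm
  have h2 : ∀ i, eLpNorm (fun x => ‖a i * g (x + y i)‖ₑ) p volume ^ subExp p
      = ‖a i‖ₑ ^ subExp p * quasi p g := fun i => by
    rw [← quasi_translate hg.1 (y i), ← quasi_const_mul hp, quasi]
    congr 1
  simp only [h2, ENNReal.tsum_mul_right] at h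
  have hfin : quasi p g ≠ ∞ := ENNReal.rpow_ne_top_of_nonneg (subExp_pos hp).le hg.2.ne
  have h3 : eLpNorm (fun x => ∑' i, ‖a i * g (x + y i)‖ₑ) p volume ≠ ∞ := by
    intro h4
    rw [h4, ENNReal.top_rpow_of_pos (subExp_pos hp)] at h
    exact (ENNReal.mul_ne_top ha hfin) (top_le_iff.1 h)
  have hmeas : AEMeasurable (fun x => ∑' i, ‖a i * g (x + y i)‖ₑ) volume :=
    AEMeasurable.tsum fun i => (hm i).enorm
  have h5 : ∀ᵐ x, ∑' i, ‖a i * g (x + y i)‖ₑ < ∞ := by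
    rcases eq_or_ne p ∞ with rfl | hpt
    · rw [eLpNorm_exponent_top] at h3
      filter_upwards [enorm_ae_le_eLpNormEssSup (fun x => ∑' i, ‖a i * g (x + y i)‖ₑ) volume]
        with x hx
      exact lt_of_le_of_lt (by simpa using hx) h3.lt_top
    · have hp0 : 0 < p.toReal := ENNReal.toReal_pos hp.ne' hpt
      have := lintegral_rpow_enorm_lt_top_of_eLpNorm_lt_top hp.ne' hpt h3.lt_top
      filter_upwards [ae_lt_top' (hmeas.enorm.pow_const _) this.ne] with x hx
      have := (ENNReal.rpow_lt_top_iff_of_pos hp0).1 hx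
      simpa using this
  filter_upwards [h5] with x hx
  refine Summable.of_norm ?_
  have := ENNReal.summable_toReal hx.ne
  simpa using this

/-! ### Approximation of maps with small differences by polynomials -/

/-- A subadditive functional with values in `[0, ∞]` that is `q`-homogeneous (as an inequality),
such as the `q`-th power of a `q`-norm. -/
structure IsQuasi {X : Type*} [AddCommGroup X] [Module ℝ X] (ρ : X → ℝ≥0∞) (q : ℝ) : Prop where
  pos : 0 < q
  add_le : ∀ x y, ρ (x + y) ≤ ρ x + ρ y
  smul_le : ∀ (c : ℝ) x, ρ (c • x) ≤ ‖c‖ₑ ^ q * ρ x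

section Abstract

variable {X : Type*} [AddCommGroup X] [Module ℝ X] {ρ : X → ℝ≥0∞} {q : ℝ}

theorem IsQuasi.map_zero (h : IsQuasi ρ q) : ρ 0 = 0 := by
  have := h.smul_le 0 0
  simpa [h.pos] using this

theorem IsQuasi.neg_le (h : IsQuasi ρ q) (x : X) : ρ (-x) ≤ ρ x := by
  have := h.smul_le (-1) x
  simpa using this

theorem IsQuasi.sub_le (h : IsQuasi ρ q) (x y : X) : ρ (x - y) ≤ ρ x + ρ y := by
  rw [sub_eq_add_neg]
  exact (h.add_le _ _).trans (by gcongr; exact h.neg_le y)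

theorem IsQuasi.sum_le (h : IsQuasi ρ q) {ι : Type*} (s : Finset ι) (x : ι → X) :
    ρ (∑ i ∈ s, x i) ≤ ∑ i ∈ s, ρ (x i) := by
  classical
  induction s using Finset.induction_on with
  | empty => simp [h.map_zero]
  | insert _ s hi ih =>
    rw [Finset.sum_insert hi, Finset.sum_insert hi]
    exact (h.add_le _ _).trans (by gcongr)

theorem IsQuasi.sum_smul_le (h : IsQuasi ρ q) {ι : Type*} (s : Finset ι) (c : ι → ℝ) (x : ι → X) :
    ρ (∑ i ∈ s, c i • x i) ≤ ∑ i ∈ s, ‖c i‖ₑ ^ q * ρ (x i) :=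
  (h.sum_le s _).trans (Finset.sum_le_sum fun _ _ => h.smul_le _ _)

/-- A sequence on `ℤ` that vanishes at `0, …, r - 1` grows at most polynomially if its `r`-th
differences do. -/
theorem IsQuasi.le_of_fwdDiff_le (h : IsQuasi ρ q) (W : ℝ≥0∞) (r s : ℕ) (e : ℤ → X)
    (he : ∀ i : ℕ, i < r → e i = 0)
    (hW : ∀ j : ℤ, ρ ((fwdDiff (1 : ℤ))^[r] e j) ≤ (1 + j.natAbs : ℕ) ^ s * W) (j : ℤ) :
    ρ (e j) ≤ (1 + j.natAbs : ℕ) ^ (s + r) * W := by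
  induction r generalizing e j with
  | zero => simpa using hW j
  | succ r ih =>
    have h1 : ∀ j : ℤ, ρ (e (j + 1) - e j) ≤ (1 + j.natAbs : ℕ) ^ (s + r) * W := by
      intro j
      refine ih (fwdDiff 1 e) (fun i hi => ?_) (fun j => by simpa using hW j) j
      have h2 := he (i + 1) (by omega)
      push_cast at h2
      simp [fwdDiff, h2, he i (by omega)]
    have h0 : e 0 = 0 := by simpa using he 0 (by omega)
    have h2 : ∀ j : ℤ, ρ (e j) ≤ (j.natAbs : ℕ) * ((1 + j.natAbs : ℕ) ^ (s + r) * W) := by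
      intro j
      induction j using Int.induction_on with
      | zero => simp [h0, h.map_zero]
      | succ j ihj =>
        have e1 : e (j + 1) = e j + (e (j + 1) - e j) := by abel
        have n1 : ((j : ℤ) + 1).natAbs = j + 1 := by omega
        rw [e1, n1]
        refine (h.add_le _ _).trans ((add_le_add ihj (h1 j)).trans ?_)
        simp only [Int.natAbs_natCast]
        calc _ = ((j + 1 : ℕ) : ℝ≥0∞) * (((1 + j : ℕ) : ℝ≥0∞) ^ (s + r) * W) := by
              push_cast; ring
          _ ≤ _ := by gcongr; omega
      | pred j ihj =>
        have e1 : e (-j - 1) = e (-j) - (e (-j - 1 + 1) - e (-j - 1)) := by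
          rw [sub_add_cancel]; abel
        have n1 : (-(j : ℤ) - 1).natAbs = j + 1 := by omega
        have n2 : (-(j : ℤ)).natAbs = j := by omega
        have h3 := h1 (-j - 1)
        rw [e1, n1]
        rw [n1] at h3
        rw [n2] at ihj
        refine (h.sub_le _ _).trans ((add_le_add ihj h3).trans ?_)
        calc _ ≤ (j : ℝ≥0∞) * (((1 + (j + 1) : ℕ) : ℝ≥0∞) ^ (s + r) * W)
                  + ((1 + (j + 1) : ℕ) : ℝ≥0∞) ^ (s + r) * W := by gcongr; omega
          _ = _ := by push_cast; ring
    refine (h2 j).trans ?_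
    rw [← add_assoc, pow_succ', mul_assoc]
    gcongr
    omega

end Abstract

/-- The Lagrange basis polynomials for the nodes `0, …, r - 1`. -/
def lag (r i : ℕ) : Polynomial ℝ := Lagrange.basis (Finset.range r) (fun k : ℕ => (k : ℝ)) i

theorem lag_eval_node {r i k : ℕ} (hi : i < r) (hk : k < r) :
    (lag r i).eval (k : ℝ) = if i = k then 1 else 0 := by
  split_ifs with h
  · subst h
    exact Lagrange.eval_basis_self (fun a _ b _ hab => by exact_mod_cast hab) (by simpa using hi)
  · exact Lagrange.eval_basis_of_ne h (by simpa using hk)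

theorem sum_lag_eval {r : ℕ} {P : Polynomial ℝ} (hP : P.degree < r) (u : ℝ) :
    ∑ i ∈ Finset.range r, (lag r i).eval u * P.eval (i : ℝ) = P.eval u := by
  have h := Lagrange.eq_interpolate (s := Finset.range r) (v := fun k : ℕ => (k : ℝ))
    (fun a _ b _ hab => Nat.cast_injective hab) (f := P) (by simpa using hP)
  conv_rhs => rw [h]
  simp [Lagrange.interpolate_apply, Polynomial.eval_finsetSum, lag, mul_comm]

theorem lag_degree_lt {r i : ℕ} (hi : i < r) : (lag r i).degree < r := by
  rw [lag, Lagrange.degree_basis (fun a _ b _ hab => by exact_mod_cast hab) (by simpa using hi)]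
  simp only [Finset.card_range]
  exact_mod_cast (by omega : r - 1 < r)

theorem natDegree_lt_of_degree_lt {P : Polynomial ℝ} {r : ℕ} (hr : 0 < r) (h : P.degree < r) :
    P.natDegree < r := by
  rcases eq_or_ne P 0 with rfl | h0
  · simpa using hr
  · exact (Polynomial.natDegree_lt_iff_degree_lt h0).2 h

theorem lag_comp_degree_lt {r i : ℕ} (hi : i < r) (a v : ℝ) :
    ((lag r i).comp (Polynomial.C v * Polynomial.X + Polynomial.C a)).degree < r := by
  have hr : 0 < r := by omega
  refine lt_of_le_of_lt Polynomial.degree_le_natDegree ?_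
  have h1 : (lag r i).natDegree < r :=
    natDegree_lt_of_degree_lt hr (lag_degree_lt hi)
  have h2 : (Polynomial.C v * Polynomial.X + Polynomial.C a).natDegree ≤ 1 :=
    Polynomial.natDegree_linear_le
  have h3 := Polynomial.natDegree_comp (p := lag r i)
    (q := Polynomial.C v * Polynomial.X + Polynomial.C a)
  exact_mod_cast lt_of_le_of_lt (h3.le.trans (Nat.mul_le_mul_left _ h2)) (by omega)

theorem fwdDiff_iter_lag {X : Type*} [AddCommGroup X] [Module ℝ X] {r i : ℕ} (hi : i < r)
    (a v : ℝ) (x : X) (j : ℤ) :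
    (fwdDiff (1 : ℤ))^[r] (fun j : ℤ => (lag r i).eval (a + j * v) • x) j = 0 := by
  set P := (lag r i).comp (Polynomial.C v * Polynomial.X + Polynomial.C a) with hP
  have hr : 0 < r := by omega
  have h1 := Polynomial.fwdDiff_iter_eq_zero_of_degree_lt
    (natDegree_lt_of_degree_lt hr (lag_comp_degree_lt hi a v))
  have h2 := congrFun h1 (j : ℝ)
  rw [fwdDiff_iter_eq_sum_shift] at h2 ⊢
  have h3 : ∀ k : ℕ, (lag r i).eval (a + ((j + k • (1 : ℤ) : ℤ) : ℝ) * v)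
      = P.eval ((j : ℝ) + k • (1 : ℝ)) := fun k => by
    simp only [hP, Polynomial.eval_comp]
    congr 1
    simp
    ring
  simp_rw [h3, ← smul_assoc]
  rw [← Finset.sum_smul]
  rw [show (∑ k ∈ Finset.range (r + 1), (((-1 : ℤ) ^ (r - k) * (r.choose k : ℤ)) •
    Polynomial.eval ((j : ℝ) + k • (1 : ℝ)) P)) = 0 from h2, zero_smul]

theorem fwdDiff_iter_comp_affine {X : Type*} [AddCommGroup X] (φ : ℝ → X) (a v : ℝ) (r : ℕ)
    (j : ℤ) :
    (fwdDiff (1 : ℤ))^[r] (fun j : ℤ => φ (a + j * v)) j = (fwdDiff v)^[r] φ (a + j * v) := by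
  induction r generalizing φ with
  | zero => rfl
  | succ r ih =>
    rw [Function.iterate_succ_apply, Function.iterate_succ_apply, ← ih]
    refine congrFun (congrArg _ (funext fun j => ?_)) j
    simp only [fwdDiff]
    congr 2
    push_cast
    ring

section Abstract

variable {X : Type*} [AddCommGroup X] [Module ℝ X] {ρ : X → ℝ≥0∞} {q : ℝ}

/-- Newton interpolation: a sequence with small `r`-th differences stays close to its Lagrange
polynomial. -/
theorem IsQuasi.sub_lag_le (h : IsQuasi ρ q) {W : ℝ≥0∞} {r : ℕ} {g : ℤ → X}
    (hW : ∀ j, ρ ((fwdDiff (1 : ℤ))^[r] g j) ≤ W) (j : ℤ) :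
    ρ (g j - ∑ i ∈ Finset.range r, (lag r i).eval (j : ℝ) • g i)
      ≤ ((1 + j.natAbs : ℕ) : ℝ≥0∞) ^ r * W := by
  have h1 := h.le_of_fwdDiff_le W r 0
    (fun j => g j - ∑ i ∈ Finset.range r, (lag r i).eval (j : ℝ) • g i) ?_ ?_ j
  · simpa using h1
  · intro k hk
    rw [sub_eq_zero, Finset.sum_eq_single k]
    · rw [Int.cast_natCast, lag_eval_node hk hk, if_pos rfl, one_smul]
    · intro i hi hik
      rw [Int.cast_natCast, lag_eval_node (by simpa using hi) hk, if_neg hik, zero_smul]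
    · intro hk'
      exact absurd (Finset.mem_range.2 hk) hk'
  · intro j
    have h2 : (fwdDiff (1 : ℤ))^[r]
        (fun j => g j - ∑ i ∈ Finset.range r, (lag r i).eval (j : ℝ) • g i) j
        = (fwdDiff (1 : ℤ))^[r] g j := by
      have h3 : (fun j : ℤ => g j - ∑ i ∈ Finset.range r, (lag r i).eval (j : ℝ) • g i)
          = g + (-1 : ℝ) • ∑ i ∈ Finset.range r, fun j : ℤ => (lag r i).eval ((0 : ℝ) + j * 1) • g i := by
        ext j
        simp [sub_eq_add_neg]
      rw [h3, fwdDiff_iter_add, fwdDiff_iter_const_smul, fwdDiff_iter_finsetSum, Pi.add_apply,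
        Pi.smul_apply, Finset.sum_apply, Finset.sum_eq_zero, smul_zero, add_zero]
      intro i hi
      exact fwdDiff_iter_lag (by simpa using hi) _ _ _ _
    rw [h2]
    simpa using hW j

/-- Interpolation of `g 1` from the sparse nodes `0, M, …, (r - 1) M`. -/
theorem IsQuasi.sub_sparse_lag_le (h : IsQuasi ρ q) {W : ℝ≥0∞} {r M : ℕ} (hM : 0 < M) {g : ℤ → X}
    (hW : ∀ j, ρ ((fwdDiff (1 : ℤ))^[r] g j) ≤ W) :
    ρ (g 1 - ∑ i ∈ Finset.range r, (lag r i).eval (1 / M : ℝ) • g (i * M))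
      ≤ (2 ^ r + ∑ i ∈ Finset.range r, ‖(lag r i).eval (1 / M : ℝ)‖ₑ ^ q *
          ((1 + i * M : ℕ) : ℝ≥0∞) ^ r) * W := by
  set Q : ℝ → X := fun u => ∑ k ∈ Finset.range r, (lag r k).eval u • g k with hQ
  have hM' : (M : ℝ) ≠ 0 := by positivity
  have h1 : ∑ i ∈ Finset.range r, (lag r i).eval (1 / M : ℝ) • Q (i * M) = Q 1 := by
    simp only [hQ, Finset.smul_sum]
    rw [Finset.sum_comm]
    refine Finset.sum_congr rfl fun k hk => ?_
    simp only [← smul_assoc, smul_eq_mul]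
    rw [← Finset.sum_smul]
    congr 1
    have h2 := sum_lag_eval (lag_comp_degree_lt (r := r) (i := k) (by simpa using hk) 0 M) (1 / M)
    simp only [Polynomial.eval_comp, Polynomial.eval_add, Polynomial.eval_mul, Polynomial.eval_C,
      Polynomial.eval_X, add_zero] at h2
    rw [mul_one_div_cancel hM'] at h2
    rw [← h2]
    refine Finset.sum_congr rfl fun i _ => ?_
    rw [mul_comm (M : ℝ)]
  have h3 : g 1 - ∑ i ∈ Finset.range r, (lag r i).eval (1 / M : ℝ) • g (i * M)
      = (g 1 - Q 1) - ∑ i ∈ Finset.range r, (lag r i).eval (1 / M : ℝ) • (g (i * M) - Q (i * M)) := by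
    simp only [smul_sub, Finset.sum_sub_distrib]
    rw [h1]
    abel
  have h4 : ∀ j : ℤ, ρ (g j - Q j) ≤ ((1 + j.natAbs : ℕ) : ℝ≥0∞) ^ r * W := fun j =>
    h.sub_lag_le hW j
  rw [h3, add_mul, Finset.sum_mul]
  refine (h.sub_le _ _).trans (add_le_add ?_ ?_)
  · have := h4 1
    norm_num at this ⊢
    exact this
  · refine (h.sum_smul_le _ _ _).trans (Finset.sum_le_sum fun i _ => ?_)
    rw [mul_assoc]
    gcongr
    have := h4 (i * M)
    have e : ((i : ℤ) * M).natAbs = i * M := by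
      rw [Int.natAbs_mul]; simp
    rw [e] at this
    push_cast at this ⊢
    exact this

/-- The values at `1 / M` of the Lagrange polynomials for the nonzero nodes become small. -/
theorem exists_sum_lag_small (hq : 0 < q) (r : ℕ) : ∃ M : ℕ, 0 < M ∧
    ∑ i ∈ (Finset.range r).erase 0, ‖(lag r i).eval (1 / M : ℝ)‖ₑ ^ q ≤ 2⁻¹ := by
  have h : Filter.Tendsto (fun M : ℕ =>
      ∑ i ∈ (Finset.range r).erase 0, ‖(lag r i).eval (1 / M : ℝ)‖ₑ ^ q) Filter.atTop (nhds 0) := by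
    rw [show (0 : ℝ≥0∞) = ∑ i ∈ (Finset.range r).erase 0, 0 by simp]
    refine tendsto_finsetSum _ fun i hi => ?_
    simp only [Finset.mem_erase, Finset.mem_range] at hi
    have h0 : (lag r i).eval 0 = 0 := by
      simpa [hi.1] using lag_eval_node (r := r) (i := i) (k := 0) hi.2 (by omega)
    have hc : Continuous fun t : ℝ => ‖(lag r i).eval t‖ₑ ^ q := by
      have := (lag r i).continuous
      fun_prop
    have := (hc.tendsto 0).comp tendsto_one_div_atTop_nhds_zero_nat
    simpa [h0, hq, Function.comp_def] using this
  obtain ⟨M, hM, hM0⟩ := ((h.eventually_le_const (by simp : (0 : ℝ≥0∞) < 2⁻¹)).and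
    (Filter.eventually_gt_atTop 0)).exists
  exact ⟨M, hM0, hM⟩

/-- **Whitney-type estimate.** A bounded map on `ℝ` whose `r`-th differences with steps at most `1`
are small is uniformly close on `[0, 1]` to its Lagrange polynomial with nodes `0, …, r - 1`.

Writing `e` for the difference, `e(a + v)` is up to a small error the combination of
`e(a), e(a + Mv), …, e(a + (r - 1)Mv)` with the coefficients of interpolation at `1/M`. For an
integer `a` the first term is small, and the other coefficients are small for large `M`, so that
the supremum of `e` is bounded by half of itself up to a small error. -/
theorem IsQuasi.exists_whitney (h : IsQuasi ρ q) {r : ℕ} (hr : 1 ≤ r) :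
    ∃ C : ℝ≥0, ∀ (φ : ℝ → X) (B : ℝ≥0) (W : ℝ≥0∞), (∀ u, ρ (φ u) ≤ B) →
      (∀ u v : ℝ, |v| ≤ 1 → ρ ((fwdDiff v)^[r] φ u) ≤ W) → ∀ u ∈ Set.Icc (0 : ℝ) 1,
        ρ (φ u - ∑ i ∈ Finset.range r, (lag r i).eval u • φ i) ≤ C * W := by
  obtain ⟨M, hM, hsmall⟩ := exists_sum_lag_small h.pos r
  set L : ℕ := 2 * (r * M) with hL
  set C₁ : ℝ≥0∞ := 2 ^ r + ∑ i ∈ Finset.range r, ‖(lag r i).eval (1 / M : ℝ)‖ₑ ^ q *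
          ((1 + i * M : ℕ) : ℝ≥0∞) ^ r with hC₁
  set C₂ : ℝ≥0∞ := ‖(lag r 0).eval (1 / M : ℝ)‖ₑ ^ q * ((1 + L : ℕ) : ℝ≥0∞) ^ r with hC₂
  have hC₁t : C₁ ≠ ∞ := by
    refine ENNReal.add_ne_top.2 ⟨by simp, ENNReal.sum_ne_top.2 fun i _ => ENNReal.mul_ne_top ?_ ?_⟩
    · exact ENNReal.rpow_ne_top_of_nonneg h.pos.le enorm_ne_top
    · exact ENNReal.pow_ne_top (ENNReal.natCast_ne_top _)
  have hC₂t : C₂ ≠ ∞ :=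
    ENNReal.mul_ne_top (ENNReal.rpow_ne_top_of_nonneg h.pos.le enorm_ne_top)
      (ENNReal.pow_ne_top (ENNReal.natCast_ne_top _))
  refine ⟨(2 * (C₁ + C₂)).toNNReal, fun φ B W hB hW u hu => ?_⟩
  rw [ENNReal.coe_toNNReal (by finiteness)]
  set e : ℝ → X := fun u => φ u - ∑ i ∈ Finset.range r, (lag r i).eval u • φ i with he
  -- differences of `e` along arithmetic progressions
  have hd : ∀ a v : ℝ, |v| ≤ 1 → ∀ j : ℤ,
      ρ ((fwdDiff (1 : ℤ))^[r] (fun j : ℤ => e (a + j * v)) j) ≤ W := by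
    intro a v hv j
    have h3 : (fun j : ℤ => e (a + j * v)) = (fun j : ℤ => φ (a + j * v))
        + (-1 : ℝ) • ∑ i ∈ Finset.range r, fun j : ℤ => (lag r i).eval (a + j * v) • φ i := by
      ext j
      simp [he, sub_eq_add_neg]
    rw [h3, fwdDiff_iter_add, fwdDiff_iter_const_smul, fwdDiff_iter_finsetSum, Pi.add_apply,
      Pi.smul_apply, Finset.sum_apply, Finset.sum_eq_zero, smul_zero, add_zero,
      fwdDiff_iter_comp_affine]
    · exact hW _ _ hv
    · intro i hi
      exact fwdDiff_iter_lag (by simpa using hi) _ _ _ _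
  -- `e` is small at integers
  have hint : ∀ a : ℤ, ρ (e a) ≤ ((1 + a.natAbs : ℕ) : ℝ≥0∞) ^ r * W := by
    intro a
    have := h.sub_lag_le (g := fun j : ℤ => φ j) (r := r) (W := W) (fun j => by
      have h1 := hW j 1 (by simp)
      have h2 := fwdDiff_iter_comp_affine φ 0 1 r j
      simp only [zero_add, mul_one] at h2
      rwa [h2]) a
    simpa [he] using this
  set S : ℝ≥0∞ := ⨆ u ∈ Set.Icc (0 : ℝ) L, ρ (e u) with hS
  have hle : ∀ u ∈ Set.Icc (0 : ℝ) L, ρ (e u) ≤ S := fun u hu => le_iSup₂ (f := fun u _ => ρ (e u)) u hu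
  have hSt : S ≠ ∞ := by
    have hb : ∀ i, ∃ D : ℝ≥0, ∀ u ∈ Set.Icc (0 : ℝ) L, ‖(lag r i).eval u‖ₑ ≤ D := by
      intro i
      obtain ⟨D, hD⟩ := (isCompact_Icc (a := (0 : ℝ)) (b := L)).exists_bound_of_continuousOn
        (lag r i).continuous.continuousOn
      refine ⟨D.toNNReal, fun u hu => ?_⟩
      rw [← ofReal_norm]
      exact ENNReal.ofReal_le_ofReal (hD u hu)
    choose D hD using hb
    refine ne_top_of_le_ne_top (b := B + ∑ i ∈ Finset.range r, (D i : ℝ≥0∞) ^ q * B) ?_ ?_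
    · refine ENNReal.add_ne_top.2 ⟨by simp, ENNReal.sum_ne_top.2 fun i _ => ENNReal.mul_ne_top ?_
        (by simp)⟩
      exact ENNReal.rpow_ne_top_of_nonneg h.pos.le (by simp)
    · refine iSup₂_le fun u hu => ?_
      refine (h.sub_le _ _).trans (add_le_add (hB u) ?_)
      refine (h.sum_smul_le _ _ _).trans (Finset.sum_le_sum fun i _ => ?_)
      exact mul_le_mul' (ENNReal.rpow_le_rpow (hD i u hu) h.pos.le) (hB i)
  -- the contraction step, with base point `a` and all nodes inside `[0, L]`
  have hstep : ∀ (a : ℤ) (v : ℝ), |v| ≤ 1 → a.natAbs ≤ L →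
      (∀ i ∈ Finset.range r, (a : ℝ) + (i * M : ℕ) * v ∈ Set.Icc (0 : ℝ) L) →
      ρ (e (a + v)) ≤ (C₁ + C₂) * W + 2⁻¹ * S := by
    intro a v hv ha hnodes
    have h1 := h.sub_sparse_lag_le hM (g := fun j : ℤ => e (a + j * v)) (hd a v hv)
    have h2 : e (a + v) = (e (a + (1 : ℤ) * v) - ∑ i ∈ Finset.range r,
        (lag r i).eval (1 / M : ℝ) • e (a + ((i * M : ℤ) : ℝ) * v)) +
        ∑ i ∈ Finset.range r, (lag r i).eval (1 / M : ℝ) • e (a + ((i * M : ℤ) : ℝ) * v) := by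
      simp
    rw [h2, add_mul, add_assoc]
    refine (h.add_le _ _).trans (add_le_add h1 ?_)
    refine (h.sum_smul_le _ _ _).trans ?_
    rw [← Finset.add_sum_erase _ _ (Finset.mem_range.2 hr : 0 ∈ Finset.range r)]
    refine add_le_add ?_ ?_
    · simp only [Nat.cast_zero, zero_mul, Int.cast_zero, add_zero]
      rw [hC₂, mul_assoc]
      gcongr
      refine (hint a).trans ?_
      gcongr
    · refine le_trans (Finset.sum_le_sum fun i hi => ?_) ((Finset.sum_mul _ _ _).symm.le.trans
        (mul_le_mul_left hsmall S))
      refine mul_le_mul' le_rfl (hle _ ?_)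
      have := hnodes i (Finset.mem_of_mem_erase hi)
      push_cast at this ⊢
      exact this
  -- `L = 2rM`, so that `(r - 1)M` steps of length at most `1` fit to the right of a point of the left
  -- half of `[0, L]` and to the left of a point of the right half
  have hS2 : S ≤ (C₁ + C₂) * W + 2⁻¹ * S := by
    refine iSup₂_le fun u hu => ?_
    have hM1 : (1 : ℝ) ≤ M := by exact_mod_cast hM
    have hLr : (L : ℝ) = 2 * (r * M) := by rw [hL]; push_cast; ring
    have hnode : ∀ i ∈ Finset.range r, ((i * M : ℕ) : ℝ) ≤ r * M := fun i hi => by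
      have : i ≤ r := (Finset.mem_range.1 hi).le
      exact_mod_cast Nat.mul_le_mul_right M this
    rcases le_total u (r * M) with hu2 | hu2
    · have h1 := Int.floor_le u
      have h2 := Int.lt_floor_add_one u
      have h0 : (0 : ℤ) ≤ ⌊u⌋ := Int.floor_nonneg.2 hu.1
      have h0' : (0 : ℝ) ≤ ⌊u⌋ := by exact_mod_cast h0
      have h3 := hstep ⌊u⌋ (u - ⌊u⌋) (by rw [abs_le]; constructor <;> linarith) ?_ ?_
      · simpa using h3
      · have : (⌊u⌋ : ℝ) ≤ (L : ℤ) := by push_cast; linarith [hu.2]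
        have : ⌊u⌋ ≤ L := by exact_mod_cast this
        omega
      · intro i hi
        have h4 := hnode i hi
        have h5 : ((i * M : ℕ) : ℝ) * (u - ⌊u⌋) ≤ (i * M : ℕ) :=
          mul_le_of_le_one_right (by positivity) (by linarith)
        have h6 : 0 ≤ ((i * M : ℕ) : ℝ) * (u - ⌊u⌋) := mul_nonneg (by positivity) (by linarith)
        exact ⟨by linarith, by linarith⟩
    · have h1 := Int.le_ceil u
      have h2 := Int.ceil_lt_add_one u
      have h0 : ⌈u⌉ ≤ L := Int.ceil_le.2 (by simpa using hu.2)
      have h00 : (0 : ℤ) ≤ ⌈u⌉ := Int.ceil_nonneg hu.1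
      have h0' : (⌈u⌉ : ℝ) ≤ L := by exact_mod_cast h0
      have h3 := hstep ⌈u⌉ (u - ⌈u⌉) (by rw [abs_le]; constructor <;> linarith) (by omega) ?_
      · simpa using h3
      · intro i hi
        have h4 := hnode i hi
        have h5 : -((i * M : ℕ) : ℝ) ≤ ((i * M : ℕ) : ℝ) * (u - ⌈u⌉) := by
          have : (0 : ℝ) ≤ (i * M : ℕ) := by positivity
          nlinarith
        have h6 : ((i * M : ℕ) : ℝ) * (u - ⌈u⌉) ≤ 0 :=
          mul_nonpos_of_nonneg_of_nonpos (by positivity) (by linarith)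
        exact ⟨by linarith, by linarith⟩
  have hfin : S ≤ 2 * (C₁ + C₂) * W := by
    have h1 : 2⁻¹ * S + 2⁻¹ * S ≤ (C₁ + C₂) * W + 2⁻¹ * S := by
      rw [← add_mul, ENNReal.inv_two_add_inv_two, one_mul]; exact hS2
    have h2 : 2⁻¹ * S ≤ (C₁ + C₂) * W :=
      (ENNReal.add_le_add_iff_right (ENNReal.mul_ne_top (by simp) hSt)).1 h1
    calc S = 2 * (2⁻¹ * S) := by
          rw [← mul_assoc, ENNReal.mul_inv_cancel (by simp) (by simp), one_mul]
      _ ≤ 2 * ((C₁ + C₂) * W) := by gcongr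
      _ = _ := by ring
  refine (hle u ⟨hu.1, hu.2.trans ?_⟩).trans hfin
  have : 1 ≤ L := by
    have := Nat.mul_le_mul hr hM
    omega
  exact_mod_cast this

end Abstract

/-! ### A rapidly decaying band-limited sampling kernel -/

section

open scoped SchwartzMap FourierTransform

theorem fourierInv_derivCLM (ψ : 𝓢(ℝ, ℂ)) (x : ℝ) :
    𝓕⁻ (SchwartzMap.derivCLM ℂ ℂ ψ) x = -(2 * Real.pi * Complex.I * x) * 𝓕⁻ ψ x := by
  have h := SchwartzMap.fourierInv_lineDerivOp_eq ψ 1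
  have h2 : LineDeriv.lineDerivOp (1 : ℝ) ψ = SchwartzMap.derivCLM ℂ ℂ ψ := by
    ext y
    rw [SchwartzMap.lineDerivOp_apply_eq_fderiv, SchwartzMap.derivCLM_apply, fderiv_apply_one_eq_deriv]
  rw [h2] at h
  have h3 : (fun x : ℝ => inner ℝ x (1 : ℝ)).HasTemperateGrowth := by fun_prop
  rw [h, smul_apply, SchwartzMap.smulLeftCLM_apply_apply h3]
  simp
  ring

/-- Poisson summation, started on the frequency side. -/
theorem tsum_fourierInv_add_int (ψ : 𝓢(ℝ, ℂ)) (x : ℝ) :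
    ∑' n : ℤ, 𝓕⁻ ψ (x + n) = ∑' n : ℤ, ψ n * fourier n (x : UnitAddCircle) := by
  have h := SchwartzMap.tsum_eq_tsum_fourier (𝓕⁻ ψ) x
  rwa [FourierTransform.fourier_fourierInv_eq] at h

theorem exists_decay (K : 𝓢(ℝ, ℂ)) (m : ℕ) :
    ∃ C : ℝ, 0 < C ∧ ∀ x : ℝ, ‖K x‖ * (1 + |x|) ^ m ≤ C := by
  have h := fun x => SchwartzMap.one_add_le_sup_seminorm_apply (𝕜 := ℂ) (m := (m, 0)) le_rfl le_rfl K x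
  refine ⟨2 ^ m * ((Finset.Iic (m, 0)).sup fun m => SchwartzMap.seminorm ℂ m.1 m.2) K + 1,
    add_pos_of_nonneg_of_pos (mul_nonneg (by positivity) (apply_nonneg _ _)) one_pos, fun x => ?_⟩
  have := h x
  simp only [norm_iteratedFDeriv_zero, Real.norm_eq_abs] at this
  linarith [mul_comm (‖K x‖) ((1 + |x|) ^ m)]

theorem tsum_inv_one_add_sq_ne_top :
    ∑' j : ℤ, (((1 + j.natAbs : ℕ) : ℝ≥0∞) ^ 2)⁻¹ ≠ ∞ := by
  have h1 : Summable fun j : ℤ => ((1 + |(j : ℝ)|) ^ 2)⁻¹ := by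
    refine Summable.of_nonneg_of_le (fun j => by positivity) (fun j => ?_)
      ((Real.summable_one_div_int_pow (p := 2)).2 one_lt_two |>.add
        (summable_of_hasFiniteSupport (f := fun j : ℤ => if j = 0 then (1 : ℝ) else 0)
          ((Set.finite_singleton (0 : ℤ)).subset fun j hj => by
            by_contra h
            simp at h
            simp [h] at hj)))
    split_ifs with h
    · simp [h]
    · rw [add_zero, one_div]
      have : (0 : ℝ) < (j : ℝ) ^ 2 := by positivity
      refine inv_anti₀ this ?_
      rw [← sq_abs (j : ℝ)]
      gcongr
      linarith
  have h2 : ∀ j : ℤ, (((1 + j.natAbs : ℕ) : ℝ≥0∞) ^ 2)⁻¹ = ENNReal.ofReal (((1 + |(j : ℝ)|) ^ 2)⁻¹) := by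
    intro j
    rw [ENNReal.ofReal_inv_of_pos (by positivity), ENNReal.ofReal_pow (by positivity)]
    congr 2
    have : (1 + |(j : ℝ)|) = ((1 + j.natAbs : ℕ) : ℝ) := by
      push_cast
      simp
    rw [this, ENNReal.ofReal_natCast]
  simp_rw [h2]
  rw [← ENNReal.ofReal_tsum_of_nonneg (fun j => by positivity) h1]
  exact ENNReal.ofReal_ne_top

/-- Samples of a Schwartz function at `u - j`, `j ∈ ℤ`, are in every weighted `ℓ_q`, uniformly in
`u ∈ [0, 1]`. -/
theorem exists_tsum_schwartz_le (K : 𝓢(ℝ, ℂ)) {q : ℝ} (hq : 0 < q) (k : ℕ) :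
    ∃ C : ℝ≥0, ∀ u ∈ Set.Icc (0 : ℝ) 1,
      ∑' j : ℤ, ‖K (u - j)‖ₑ ^ q * ((1 + j.natAbs : ℕ) : ℝ≥0∞) ^ k ≤ C := by
  obtain ⟨m, hm⟩ := exists_nat_ge ((k + 2) / q)
  have hm' : (k + 2 : ℕ) ≤ m * q := by
    rw [div_le_iff₀ hq] at hm
    push_cast
    exact hm
  obtain ⟨C, hC0, hC⟩ := exists_decay K m
  set D : ℝ≥0∞ := ENNReal.ofReal (C * 2 ^ m) ^ q with hD
  have hDt : D ≠ ∞ := ENNReal.rpow_ne_top_of_nonneg hq.le ENNReal.ofReal_ne_top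
  refine ⟨(D * ∑' j : ℤ, (((1 + j.natAbs : ℕ) : ℝ≥0∞) ^ 2)⁻¹).toNNReal, fun u hu => ?_⟩
  rw [ENNReal.coe_toNNReal (ENNReal.mul_ne_top hDt tsum_inv_one_add_sq_ne_top),
    ← ENNReal.tsum_mul_left]
  refine ENNReal.tsum_le_tsum fun j => ?_
  set b : ℝ≥0∞ := ((1 + j.natAbs : ℕ) : ℝ≥0∞) with hb
  have hb1 : 1 ≤ b := by rw [hb]; exact_mod_cast Nat.le_add_right 1 _
  have hb0 : b ≠ 0 := (zero_lt_one.trans_le hb1).ne'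
  have hbt : b ≠ ∞ := ENNReal.natCast_ne_top _
  -- pointwise decay in terms of `j`
  have h1 : ‖K (u - j)‖ₑ * b ^ m ≤ ENNReal.ofReal (C * 2 ^ m) := by
    have hbr : b = ENNReal.ofReal (1 + |(j : ℝ)|) := by
      rw [hb, ← ENNReal.ofReal_natCast]
      congr 1
      push_cast
      simp
    rw [hbr, ← ofReal_norm, ← ENNReal.ofReal_pow (by positivity), ← ENNReal.ofReal_mul (norm_nonneg _)]
    refine ENNReal.ofReal_le_ofReal ?_
    have h2 : 1 + |(j : ℝ)| ≤ 2 * (1 + |u - j|) := by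
      have : |(j : ℝ)| ≤ |u - j| + |u| := by
        have := abs_sub_abs_le_abs_sub (j : ℝ) u
        rw [abs_sub_comm] at this
        linarith
      have h3 : |u| ≤ 1 := abs_le.2 ⟨by linarith [hu.1], hu.2⟩
      linarith [abs_nonneg (u - j)]
    calc ‖K (u - j)‖ * (1 + |(j : ℝ)|) ^ m ≤ ‖K (u - j)‖ * (2 * (1 + |u - j|)) ^ m := by gcongr
      _ = ‖K (u - j)‖ * (1 + |u - j|) ^ m * 2 ^ m := by rw [mul_pow]; ring
      _ ≤ C * 2 ^ m := by gcongr; exact hC _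
  have h2 : ‖K (u - j)‖ₑ ^ q * b ^ (k + 2) ≤ D := by
    calc ‖K (u - j)‖ₑ ^ q * b ^ (k + 2) ≤ ‖K (u - j)‖ₑ ^ q * (b ^ m) ^ q := by
          gcongr
          rw [← ENNReal.rpow_natCast b m, ← ENNReal.rpow_mul, ← ENNReal.rpow_natCast]
          exact ENNReal.rpow_le_rpow_of_exponent_le hb1 hm'
      _ = (‖K (u - j)‖ₑ * b ^ m) ^ q := (ENNReal.mul_rpow_of_nonneg _ _ hq.le).symm
      _ ≤ D := ENNReal.rpow_le_rpow h1 hq.le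
  rw [← div_eq_mul_inv, ENNReal.le_div_iff_mul_le (Or.inl (by simp [hb0])) (Or.inl (by simp [hbt])),
    mul_assoc, ← pow_add]
  exact h2

/-- A smooth bump on the frequency side, equal to `1` on `[-1/32, 1/32]` and supported in
`[-1/16, 1/16]`. -/
def freqBump : ContDiffBump (0 : ℝ) := ⟨1 / 32, 1 / 16, by norm_num, by norm_num⟩

theorem hasCompactSupport_ofReal_comp {f : ℝ → ℝ} (hf : HasCompactSupport f) :
    HasCompactSupport fun x => (f x : ℂ) :=
  hf.comp_left (g := fun y : ℝ => (y : ℂ)) (by simp)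

/-- The bump `freqBump` as a complex Schwartz function. -/
def freqBumpS : 𝓢(ℝ, ℂ) :=
  (hasCompactSupport_ofReal_comp freqBump.hasCompactSupport).toSchwartzMap
    (Complex.ofRealCLM.contDiff.comp freqBump.contDiff)

theorem freqBumpS_apply (x : ℝ) : freqBumpS x = (freqBump x : ℂ) := rfl

theorem freqBumpS_of_le {x : ℝ} (hx : |x| ≤ 1 / 32) : freqBumpS x = 1 := by
  rw [freqBumpS_apply, freqBump.one_of_mem_closedBall (by simpa [freqBump] using hx)]
  simp

theorem freqBumpS_of_ge {x : ℝ} (hx : 1 / 16 ≤ |x|) : freqBumpS x = 0 := by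
  rw [freqBumpS_apply, freqBump.zero_of_le_dist (by simpa [freqBump] using hx)]
  simp

/-- The sampling kernel: its Fourier transform is `freqBumpS`. -/
def sampKernel : 𝓢(ℝ, ℂ) := 𝓕⁻ freqBumpS

theorem iterate_derivCLM_freqBumpS_far (l : ℕ) {x : ℝ} (hx : 1 / 16 < |x|) :
    ((SchwartzMap.derivCLM ℂ ℂ)^[l] freqBumpS) x = 0 := by
  induction l generalizing x with
  | zero => exact freqBumpS_of_ge hx.le
  | succ l ih =>
    rw [Function.iterate_succ_apply', SchwartzMap.derivCLM_apply]
    have : ((SchwartzMap.derivCLM ℂ ℂ)^[l] freqBumpS : ℝ → ℂ) =ᶠ[nhds x] fun _ => 0 := by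
      filter_upwards [(isOpen_lt continuous_const continuous_abs).mem_nhds hx] with y hy
      exact ih hy
    rw [this.deriv_eq, deriv_const]

theorem iterate_derivCLM_freqBumpS_near (l : ℕ) {x : ℝ} (hx : |x| < 1 / 32) :
    ((SchwartzMap.derivCLM ℂ ℂ)^[l] freqBumpS) x = if l = 0 then 1 else 0 := by
  induction l generalizing x with
  | zero => exact freqBumpS_of_le hx.le
  | succ l ih =>
    rw [Function.iterate_succ_apply', SchwartzMap.derivCLM_apply]
    have : ((SchwartzMap.derivCLM ℂ ℂ)^[l] freqBumpS : ℝ → ℂ)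
        =ᶠ[nhds x] fun _ => if l = 0 then 1 else 0 := by
      filter_upwards [(isOpen_lt continuous_abs continuous_const).mem_nhds hx] with y hy
      exact ih hy
    rw [this.deriv_eq, deriv_const]
    simp

theorem fourierInv_iterate_derivCLM (l : ℕ) (ψ : 𝓢(ℝ, ℂ)) (x : ℝ) :
    𝓕⁻ ((SchwartzMap.derivCLM ℂ ℂ)^[l] ψ) x = (-(2 * Real.pi * Complex.I * x)) ^ l * 𝓕⁻ ψ x := by
  induction l with
  | zero => simp
  | succ l ih =>
    rw [Function.iterate_succ_apply', fourierInv_derivCLM, ih]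
    ring

/-- The moments of the samples of `sampKernel`, by Poisson summation. -/
theorem tsum_sampKernel_moment (l : ℕ) (x : ℝ) :
    ∑' n : ℤ, ((x + n : ℝ) : ℂ) ^ l * sampKernel (x + n) = if l = 0 then 1 else 0 := by
  have h := tsum_fourierInv_add_int ((SchwartzMap.derivCLM ℂ ℂ)^[l] freqBumpS) x
  have hr : ∑' n : ℤ, ((SchwartzMap.derivCLM ℂ ℂ)^[l] freqBumpS) n * fourier n (x : UnitAddCircle)
      = if l = 0 then 1 else 0 := by
    rw [tsum_eq_single 0]
    · rw [Int.cast_zero, iterate_derivCLM_freqBumpS_near l (by norm_num)]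
      simp
    · intro n hn
      rw [iterate_derivCLM_freqBumpS_far, zero_mul]
      have : (1 : ℝ) ≤ |(n : ℝ)| := by exact_mod_cast Int.one_le_abs hn
      linarith
  rw [hr] at h
  simp_rw [fourierInv_iterate_derivCLM] at h
  have hc : (-(2 * Real.pi * Complex.I)) ^ l ≠ 0 := by
    apply pow_ne_zero
    simp [Real.pi_ne_zero]
  have h2 : (-(2 * Real.pi * Complex.I)) ^ l *
      ∑' n : ℤ, ((x + n : ℝ) : ℂ) ^ l * sampKernel (x + n) = if l = 0 then 1 else 0 := by
    rw [← h, ← tsum_mul_left]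
    refine tsum_congr fun n => ?_
    rw [sampKernel, ← mul_assoc, ← mul_pow]
    congr 2
    ring
  split_ifs at h2 ⊢ with hl
  · subst hl
    simpa using h2
  · exact (mul_eq_zero.1 h2).resolve_left hc

theorem summable_sampKernel_mul_pow {u : ℝ} (hu : u ∈ Set.Icc (0 : ℝ) 1) (k : ℕ) :
    Summable fun j : ℤ => ‖sampKernel (u - j)‖ * (1 + |(j : ℝ)|) ^ k := by
  obtain ⟨C, hC⟩ := exists_tsum_schwartz_le sampKernel one_pos k
  have h := ENNReal.summable_toReal (ne_top_of_le_ne_top ENNReal.coe_ne_top (hC u hu))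
  refine h.congr fun j => ?_
  rw [ENNReal.rpow_one, ENNReal.toReal_mul, ENNReal.toReal_pow, ENNReal.toReal_natCast]
  simp

/-- Sampling with the kernel `sampKernel` reproduces polynomials. -/
theorem hasSum_sampKernel_poly {u : ℝ} (hu : u ∈ Set.Icc (0 : ℝ) 1) (P : Polynomial ℝ) :
    HasSum (fun j : ℤ => sampKernel (u - j) * ((P.eval (j : ℝ) : ℝ) : ℂ)) ((P.eval u : ℝ) : ℂ) := by
  have hmom : ∀ l : ℕ, HasSum (fun j : ℤ => sampKernel (u - j) * ((j : ℝ) - u : ℝ) ^ l)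
      (if l = 0 then 1 else 0) := by
    intro l
    have hs : Summable fun j : ℤ => sampKernel (u - j) * (((j : ℝ) - u : ℝ) : ℂ) ^ l := by
      refine Summable.of_norm_bounded (summable_sampKernel_mul_pow hu l) fun j => ?_
      rw [norm_mul, norm_pow, Complex.norm_real, Real.norm_eq_abs]
      gcongr
      have := abs_sub (j : ℝ) u
      have h3 : |u| ≤ 1 := abs_le.2 ⟨by linarith [hu.1], hu.2⟩
      linarith
    have h1 := tsum_sampKernel_moment l u
    rw [← (Equiv.neg ℤ).tsum_eq] at h1
    have h2 : ∑' j : ℤ, sampKernel (u - j) * (((j : ℝ) - u : ℝ) : ℂ) ^ l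
        = (-1) ^ l * if l = 0 then 1 else 0 := by
      rw [← h1, ← tsum_mul_left]
      refine tsum_congr fun j => ?_
      simp only [Equiv.neg_apply]
      rw [← mul_assoc, ← mul_pow]
      push_cast
      rw [mul_comm, ← sub_eq_add_neg]
      congr 2
      ring
    have h4 := hs.hasSum
    rw [h2] at h4
    convert h4 using 1
    split_ifs with hl
    · simp [hl]
    · simp
  set c := fun l => (Polynomial.taylor u P).coeff l with hc
  set s := Finset.range ((Polynomial.taylor u P).natDegree + 1) with hsdef
  have hP : ∀ x : ℝ, P.eval x = ∑ l ∈ s, c l * (x - u) ^ l := by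
    intro x
    have h1 := Polynomial.taylor_eval_sub u P x
    rw [← h1, Polynomial.eval_eq_sum_range]
  have h := hasSum_sum (s := s) fun l (_ : l ∈ s) => (hmom l).mul_left (c l : ℂ)
  have e1 : (fun j : ℤ => sampKernel (u - j) * ((P.eval (j : ℝ) : ℝ) : ℂ)) =
      fun j : ℤ => ∑ l ∈ s, (c l : ℂ) * (sampKernel (u - j) * (((j : ℝ) - u : ℝ) : ℂ) ^ l) := by
    funext j
    rw [hP, Complex.ofReal_sum, Finset.mul_sum]
    refine Finset.sum_congr rfl fun l _ => ?_
    push_cast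
    ring
  have e2 : ((P.eval u : ℝ) : ℂ) = ∑ l ∈ s, (c l : ℂ) * if l = 0 then 1 else 0 := by
    rw [Finset.sum_eq_single 0]
    · simp [hc]
    · intro l _ hl
      simp [hl]
    · intro h0
      simp [hsdef] at h0
  rw [e1, e2]
  exact h

/-- The periodization of `sampKernel` to the circle with `N = 16 n` nodes, centred at the node `j`,
written as a trigonometric polynomial of degree at most `n`. -/
def circKernel (n : ℕ) (j : ℤ) (y : AddCircle (2 * Real.pi)) : ℂ :=
  ∑ m ∈ Finset.Icc (-(n : ℤ)) n, ((16 * n : ℝ) : ℂ)⁻¹ * freqBumpS (m / (16 * n)) *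
    fourier (-m) ((j / (16 * n) : ℝ) : UnitAddCircle) * fourier m y

theorem circKernel_eq_tsum {n : ℕ} (hn : 1 ≤ n) (j : ℤ) (u : ℝ) :
    circKernel n j ((2 * Real.pi / (16 * n) * u : ℝ) : AddCircle (2 * Real.pi))
      = ∑' m : ℤ, sampKernel (u - (j + 16 * n * m)) := by
  set N : ℝ := 16 * n with hN
  have hN0 : 0 < N := by
    have : (1 : ℝ) ≤ n := by exact_mod_cast hn
    rw [hN]; positivity
  have hsupp : HasCompactSupport fun x : ℝ => ((N : ℂ)⁻¹ * freqBumpS (x / N)) := by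
    refine HasCompactSupport.intro (isCompact_closedBall (0 : ℝ) N) fun x hx => ?_
    have hx' : N < |x| := by simpa using hx
    rw [freqBumpS_of_ge, mul_zero]
    rw [abs_div, abs_of_pos hN0, le_div_iff₀ hN0]
    linarith
  have hsm : ContDiff ℝ (⊤ : ℕ∞) fun x : ℝ => ((N : ℂ)⁻¹ * freqBumpS (x / N)) :=
    contDiff_const.mul ((freqBumpS.smooth ⊤).comp (contDiff_id.div_const N))
  set ψ : 𝓢(ℝ, ℂ) := hsupp.toSchwartzMap hsm with hψ
  have hψa : ∀ x : ℝ, ψ x = (N : ℂ)⁻¹ * freqBumpS (x / N) := fun x => rfl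
  have hinv : ∀ x : ℝ, 𝓕⁻ ψ x = sampKernel (N * x) := by
    intro x
    rw [sampKernel, SchwartzMap.fourierInv_coe, SchwartzMap.fourierInv_coe, Real.fourierInv_eq',
      Real.fourierInv_eq']
    have h1 := Measure.integral_comp_div (fun v : ℝ =>
      Complex.exp (((2 * Real.pi * inner ℝ v (N * x) : ℝ) : ℂ) * Complex.I) • freqBumpS v) N
    rw [abs_of_pos hN0] at h1
    rw [← inv_smul_smul₀ hN0.ne' (∫ v : ℝ,
      Complex.exp (((2 * Real.pi * inner ℝ v (N * x) : ℝ) : ℂ) * Complex.I) • freqBumpS v),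
      ← h1, ← integral_smul]
    refine integral_congr_ae (Filter.Eventually.of_forall fun v => ?_)
    simp only [hψa]
    have h2 : inner ℝ (v / N) (N * x) = inner ℝ v x := by
      simp only [RCLike.inner_apply, conj_trivial]
      field_simp
    rw [h2]
    simp only [smul_eq_mul, Complex.real_smul]
    push_cast
    ring
  have h := tsum_fourierInv_add_int ψ ((u - j) / N)
  have hl : ∑' m : ℤ, 𝓕⁻ ψ ((u - j) / N + m) = ∑' m : ℤ, sampKernel (u - (j + N * m)) := by
    rw [← (Equiv.neg ℤ).tsum_eq]
    refine tsum_congr fun m => ?_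
    rw [hinv]
    congr 1
    simp only [Equiv.neg_apply]
    push_cast
    field_simp
    ring
  rw [← hl, h, tsum_eq_sum (s := Finset.Icc (-(n : ℤ)) n), circKernel]
  · refine Finset.sum_congr rfl fun m _ => ?_
    rw [hψa, mul_assoc]
    congr 1
    rw [fourier_coe_apply, fourier_coe_apply, fourier_coe_apply, ← Complex.exp_add]
    congr 1
    have hpi : (Real.pi : ℂ) ≠ 0 := by exact_mod_cast Real.pi_ne_zero
    have hnC : (n : ℂ) ≠ 0 := by exact_mod_cast (by omega : n ≠ 0)
    simp only [hN]
    push_cast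
    field_simp
    ring
  · intro m hm
    rw [hψa, freqBumpS_of_ge, mul_zero, zero_mul]
    rw [Finset.mem_Icc, ← abs_le] at hm
    have hm' : (n : ℝ) < |(m : ℝ)| := by
      have : (n : ℤ) < |m| := not_le.1 hm
      exact_mod_cast this
    rw [abs_div, abs_of_pos hN0, le_div_iff₀ hN0, hN]
    linarith

end

/-! ### Sampling along coordinate directions -/

/-- The real vector space of almost everywhere strongly measurable functions on the torus. -/
def aesmSub (d : ℕ) : Submodule ℝ (Torus d → ℂ) where
  carrier := {g | AEStronglyMeasurable g volume}
  add_mem' := fun hf hg => hf.add hg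
  zero_mem' := aestronglyMeasurable_zero
  smul_mem' := fun c _ hg => hg.const_smul c

theorem isQuasi_quasi {p : ℝ≥0∞} (hp : 0 < p) :
    IsQuasi (fun g : aesmSub d => quasi p (g : Torus d → ℂ)) (subExp p) where
  pos := subExp_pos hp
  add_le := fun f g => quasi_add_le hp f.2 g.2
  smul_le := fun c g => by
    have h := quasi_const_mul hp (c : ℂ) (g : Torus d → ℂ)
    have e : ((c • g : aesmSub d) : Torus d → ℂ) = fun x => (c : ℂ) * (g : Torus d → ℂ) x := by
      ext x
      simp
    simp only [e, h]
    refine le_of_eq ?_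
    congr 2
    rw [← ofReal_norm, ← ofReal_norm, Complex.norm_real]

/-- The class in the torus of the vector `t e_i`. -/
def axis (i : Fin d) (t : ℝ) : Torus d := Pi.single i (t : AddCircle (2 * Real.pi))

theorem axis_add (i : Fin d) (s t : ℝ) : axis i (s + t) = axis i s + axis i t := by
  rw [axis, axis, axis, ← Pi.single_add]
  simp

theorem axis_nsmul (i : Fin d) (k : ℕ) (t : ℝ) : axis i (k * t) = k • axis i t := by
  induction k with
  | zero => simp [axis]
  | succ k ih =>
    rw [succ_nsmul, ← ih, ← axis_add]
    congr 1
    push_cast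
    ring

/-- All coordinate differences of `f` of order `r` with steps at most `s` are bounded by `W`. -/
def AxisBound (p : ℝ≥0∞) (r : ℕ) (s : ℝ) (W : ℝ≥0∞) (f : Torus d → ℂ) : Prop :=
  ∀ (i : Fin d) (t : ℝ), |t| ≤ s → quasi p ((fwdDiff (axis i t))^[r] f) ≤ W

theorem fwdDiff_iter_translate (h y : Torus d) (r : ℕ) (f : Torus d → ℂ) :
    (fwdDiff h)^[r] (fun x => f (x + y)) = fun x => (fwdDiff h)^[r] f (x + y) := by
  funext x
  exact fwdDiff_iter_comp_add h f y r x

theorem aesm_fwdDiff_iter (h : Torus d) (r : ℕ) {f : Torus d → ℂ}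
    (hf : AEStronglyMeasurable f volume) :
    AEStronglyMeasurable ((fwdDiff h)^[r] f) volume := by
  induction r with
  | zero => exact hf
  | succ r ih =>
    rw [Function.iterate_succ_apply']
    exact (aesm_translate ih h).sub ih

theorem AxisBound.translate {p : ℝ≥0∞} {r : ℕ} {s : ℝ} {W : ℝ≥0∞} {f : Torus d → ℂ}
    (hf : AEStronglyMeasurable f volume) (h : AxisBound p r s W f) (y : Torus d) :
    AxisBound p r s W (fun x => f (x + y)) := by
  intro i t ht
  rw [fwdDiff_iter_translate, quasi_translate (aesm_fwdDiff_iter _ _ hf)]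
  exact h i t ht

theorem memLp_translate {p : ℝ≥0∞} {f : Torus d → ℂ} (hf : MemLp f p volume) (y : Torus d) :
    MemLp (fun x => f (x + y)) p volume :=
  hf.comp_measurePreserving (measurePreserving_translate y)

/-- Sampling with step `s` approximates `f` up to differences with step at most `s`, at points of
one cell. -/
theorem exists_cell_sampling_le {p : ℝ≥0∞} (hp : 0 < p) {r : ℕ} (hr : 1 ≤ r) :
    ∃ C : ℝ≥0, ∀ (f : Torus d → ℂ) (s : ℝ) (W : ℝ≥0∞), 0 ≤ s → MemLp f p volume →
      AxisBound p r s W f → ∀ (i : Fin d), ∀ u ∈ Set.Icc (0 : ℝ) 1,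
      quasi p (fun x => f (x + axis i (s * u)) -
        ∑' j : ℤ, sampKernel (u - j) * f (x + axis i (s * j))) ≤ C * W := by
  have hq := isQuasi_quasi (d := d) hp
  obtain ⟨C₁, hC₁⟩ := hq.exists_whitney hr
  obtain ⟨C₂, hC₂⟩ := exists_tsum_schwartz_le sampKernel hq.pos r
  refine ⟨C₁ + C₂, fun f s W hs hf hW i u hu => ?_⟩
  have hfin : quasi p f ≠ ∞ := ENNReal.rpow_ne_top_of_nonneg hq.pos.le hf.2.ne
  set φ : ℝ → aesmSub d := fun u => ⟨fun x => f (x + axis i (s * u)), aesm_translate hf.1 _⟩ with hφ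
  have hdiff : ∀ u v x, (((fwdDiff v)^[r] φ u : aesmSub d) : Torus d → ℂ) x
      = (fwdDiff (axis i (s * v)))^[r] f (x + axis i (s * u)) := by
    intro u v x
    rw [fwdDiff_iter_eq_sum_shift, fwdDiff_iter_eq_sum_shift]
    simp only [AddSubmonoidClass.coe_finsetSum, Finset.sum_apply]
    refine Finset.sum_congr rfl fun k _ => ?_
    rw [Submodule.coe_smul_of_tower, Pi.smul_apply]
    congr 2
    rw [add_assoc, ← axis_nsmul, ← axis_add, nsmul_eq_mul]
    change f (x + axis i (s * (u + k * v))) = _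
    congr 3
    ring
  have hφB : ∀ u, quasi p (φ u : Torus d → ℂ) ≤ (quasi p f).toNNReal := fun u => by
    rw [ENNReal.coe_toNNReal hfin]
    exact (quasi_translate hf.1 _).le
  have hφW : ∀ u v : ℝ, |v| ≤ 1 →
      quasi p (((fwdDiff v)^[r] φ u : aesmSub d) : Torus d → ℂ) ≤ W := by
    intro u v hv
    rw [funext (hdiff u v), quasi_translate (aesm_fwdDiff_iter _ _ hf.1)]
    refine hW i _ ?_
    rw [abs_mul, abs_of_nonneg hs]
    exact mul_le_of_le_one_right hs hv
  -- the Lagrange polynomial of `f` along the line through `x`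
  set P : ℝ → Torus d → ℂ := fun u x =>
    ∑ k ∈ Finset.range r, (((lag r k).eval u : ℝ) : ℂ) * f (x + axis i (s * k)) with hP
  have hcoe : ∀ u : ℝ, ((φ u - ∑ k ∈ Finset.range r, (lag r k).eval u • φ k : aesmSub d) : Torus d → ℂ)
      = fun x => f (x + axis i (s * u)) - P u x := by
    intro u
    ext x
    simp [hφ, hP]
  have h1 : quasi p (fun x => f (x + axis i (s * u)) - P u x) ≤ C₁ * W := by
    rw [← hcoe]
    exact hC₁ φ _ W hφB hφW u hu
  have h2 : ∀ j : ℤ, quasi p (fun x => f (x + axis i (s * j)) - P j x)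
      ≤ ((1 + j.natAbs : ℕ) : ℝ≥0∞) ^ r * W := by
    intro j
    rw [← hcoe]
    refine hq.sub_lag_le (g := fun j : ℤ => φ j) (fun j => ?_) j
    have h3 := fwdDiff_iter_comp_affine φ 0 1 r j
    simp only [zero_add, mul_one] at h3
    rw [h3]
    exact hφW _ 1 (by simp)
  have hmP : ∀ u, AEStronglyMeasurable (P u) volume := fun u =>
    Finset.aestronglyMeasurable_fun_sum _ fun k _ => (aesm_translate hf.1 _).const_mul _
  have hm : ∀ u, AEStronglyMeasurable (fun x => f (x + axis i (s * u)) - P u x) volume := fun u =>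
    (aesm_translate hf.1 _).sub (hmP u)
  have hKq : ∑' j : ℤ, ‖sampKernel (u - j)‖ₑ ^ subExp p ≠ ∞ := by
    refine ne_top_of_le_ne_top (ENNReal.coe_ne_top (r := C₂)) (le_trans ?_ (hC₂ u hu))
    refine ENNReal.tsum_le_tsum fun j => le_mul_of_one_le_right' ?_
    exact one_le_pow₀ (by exact_mod_cast Nat.le_add_right 1 _)
  have hae := ae_summable_translate hp hf (fun j : ℤ => axis i (s * j)) hKq
  have hid : (fun x => f (x + axis i (s * u)) - ∑' j : ℤ, sampKernel (u - j) * f (x + axis i (s * j)))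
      =ᵐ[volume] (fun x => f (x + axis i (s * u)) - P u x) -
        fun x => ∑' j : ℤ, sampKernel (u - j) * (f (x + axis i (s * j)) - P j x) := by
    filter_upwards [hae] with x hx
    have h3 : HasSum (fun j : ℤ => sampKernel (u - j) * P j x) (P u x) := by
      have h4 := hasSum_sum (s := Finset.range r) fun k (_ : k ∈ Finset.range r) =>
        (hasSum_sampKernel_poly hu (lag r k)).mul_right (f (x + axis i (s * k)))
      have e : (fun j : ℤ => sampKernel (u - j) * P j x) = fun j : ℤ => ∑ k ∈ Finset.range r,
          sampKernel (u - j) * (((lag r k).eval (j : ℝ) : ℝ) : ℂ) * f (x + axis i (s * k)) := by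
        funext j
        simp only [hP, Finset.mul_sum, mul_assoc]
      rw [e]
      exact h4
    simp only [Pi.sub_apply, mul_sub]
    rw [hx.tsum_sub h3.summable, h3.tsum_eq]
    ring
  rw [quasi_congr_ae hid]
  have hmK : ∀ j : ℤ, AEStronglyMeasurable
      (fun x => sampKernel (u - j) * (f (x + axis i (s * j)) - P j x)) volume := fun j =>
    (hm j).const_mul _
  have hmT : AEStronglyMeasurable
      (fun x => ∑' j : ℤ, sampKernel (u - j) * (f (x + axis i (s * j)) - P j x)) volume :=
    (AEMeasurable.tsum fun j => (hmK j).aemeasurable).aestronglyMeasurable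
  rw [ENNReal.coe_add, add_mul]
  refine (quasi_sub_le hp (hm u) hmT).trans (add_le_add h1 ((quasi_tsum_le hp hmK).trans ?_))
  calc ∑' j : ℤ, quasi p (fun x => sampKernel (u - j) * (f (x + axis i (s * j)) - P j x))
      ≤ ∑' j : ℤ, ‖sampKernel (u - j)‖ₑ ^ subExp p * ((1 + j.natAbs : ℕ) : ℝ≥0∞) ^ r * W := by
        refine ENNReal.tsum_le_tsum fun j => ?_
        rw [quasi_const_mul hp, mul_assoc]
        gcongr
        exact h2 j
    _ ≤ C₂ * W := by
        rw [ENNReal.tsum_mul_right]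
        gcongr
        exact hC₂ u hu

/-- The distance between neighbouring nodes of the grid with `16 n` nodes on the circle. -/
def gridStep (n : ℕ) : ℝ := 2 * Real.pi / (16 * n)

theorem axis_period {n : ℕ} (hn : 1 ≤ n) (i : Fin d) (j m : ℤ) :
    axis i (gridStep n * (m * (16 * n : ℕ) + j : ℤ)) = axis i (gridStep n * j) := by
  rw [axis, axis]
  congr 1
  have hn0 : (n : ℝ) ≠ 0 := by positivity
  have e : gridStep n * ((m * (16 * n : ℕ) + j : ℤ) : ℝ) = gridStep n * j + m * (2 * Real.pi) := by
    rw [gridStep]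
    push_cast
    field_simp
    ring
  rw [e, AddCircle.coe_add]
  have : ((m * (2 * Real.pi) : ℝ) : AddCircle (2 * Real.pi)) = 0 :=
    (AddCircle.coe_eq_zero_iff _).2 ⟨m, by simp⟩
  rw [this, add_zero]

/-- Grouping a series over `ℤ` by residue classes. -/
theorem sum_tsum_residue {N : ℕ} (hN : 0 < N) {F : ℤ → ℂ} (hF : Summable F) :
    ∑ j ∈ Finset.range N, ∑' m : ℤ, F (m * N + j) = ∑' j : ℤ, F j := by
  have : NeZero N := ⟨hN.ne'⟩
  have hs := (Equiv.summable_iff (Int.divModEquiv N).symm).2 hF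
  have h1 := hs.tsum_prod
  simp only [tsum_fintype] at h1
  have h2 := Summable.tsum_finsetSum (s := Finset.univ)
    (f := fun (i : Fin N) (b : ℤ) => (F ∘ (Int.divModEquiv N).symm) (b, i)) fun i _ =>
    hs.comp_injective (i := fun b : ℤ => (b, i)) fun a b h => (Prod.mk.inj h).1
  rw [← (Int.divModEquiv N).symm.tsum_eq F, Finset.sum_range]
  exact (h1.trans h2).symm

theorem sum_tsum_residue_ennreal {N : ℕ} (hN : 0 < N) (F : ℤ → ℝ≥0∞) :
    ∑ j ∈ Finset.range N, ∑' m : ℤ, F (m * N + j) = ∑' j : ℤ, F j := by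
  have : NeZero N := ⟨hN.ne'⟩
  rw [← (Int.divModEquiv N).symm.tsum_eq, ENNReal.tsum_prod', ENNReal.tsum_comm, tsum_fintype,
    Finset.sum_range]
  simp [Int.divModEquiv]

/-- A point of the circle is a grid node plus a fraction of the grid step. -/
theorem exists_grid_repr {n : ℕ} (hn : 1 ≤ n) (y : AddCircle (2 * Real.pi)) :
    ∃ (a : ℤ), ∃ u ∈ Set.Icc (0 : ℝ) 1, y = ((gridStep n * (a + u) : ℝ) : AddCircle (2 * Real.pi)) := by
  induction y using QuotientAddGroup.induction_on with
  | H t =>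
    refine ⟨⌊t / gridStep n⌋, Int.fract (t / gridStep n), ⟨Int.fract_nonneg _, (Int.fract_lt_one _).le⟩, ?_⟩
    have hs : gridStep n ≠ 0 := by
      have : (n : ℝ) ≠ 0 := by positivity
      have := Real.pi_ne_zero
      rw [gridStep]
      positivity
    rw [Int.floor_add_fract, mul_div_cancel₀ _ hs]

theorem circKernel_grid {n : ℕ} (hn : 1 ≤ n) (a : ℤ) (u : ℝ) (j : ℤ) :
    circKernel n j ((gridStep n * (a + u) : ℝ) : AddCircle (2 * Real.pi))
      = ∑' m : ℤ, sampKernel (u - ((m * (16 * n : ℕ) + j : ℤ) - a)) := by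
  rw [gridStep, circKernel_eq_tsum hn]
  refine tsum_congr fun m => ?_
  congr 1
  push_cast
  ring

/-- Sampling in the `i`-th coordinate on the grid with `16 n` nodes; as a function of `y`, this is a
trigonometric polynomial. -/
def sampleAxis (n : ℕ) (i : Fin d) (y : AddCircle (2 * Real.pi)) (g : Torus d → ℂ) (x : Torus d) : ℂ :=
  ∑ j ∈ Finset.range (16 * n), circKernel n j y * g (x + axis i (gridStep n * j))

theorem exists_circKernel_sum_le {q : ℝ} (hq : 0 < q) (hq1 : q ≤ 1) : ∃ C : ℝ≥0, ∀ n : ℕ, 1 ≤ n →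
    ∀ y, ∑ j ∈ Finset.range (16 * n), ‖circKernel n j y‖ₑ ^ q ≤ C := by
  obtain ⟨C, hC⟩ := exists_tsum_schwartz_le sampKernel hq 0
  refine ⟨C, fun n hn y => ?_⟩
  obtain ⟨a, u, hu, rfl⟩ := exists_grid_repr hn y
  calc _ ≤ ∑ j ∈ Finset.range (16 * n), ∑' m : ℤ,
        ‖sampKernel (u - ((m * (16 * n : ℕ) + j : ℤ) - a))‖ₑ ^ q := by
        refine Finset.sum_le_sum fun j _ => ?_
        rw [circKernel_grid hn]
        exact (ENNReal.rpow_le_rpow enorm_tsum_le_tsum_enorm hq.le).trans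
          (tsum_rpow_le_tsum_rpow hq hq1 _)
    _ = ∑' j : ℤ, ‖sampKernel (u - ((j : ℤ) - a))‖ₑ ^ q :=
        sum_tsum_residue_ennreal (by omega) fun j : ℤ => ‖sampKernel (u - ((j : ℤ) - a))‖ₑ ^ q
    _ = ∑' j : ℤ, ‖sampKernel (u - j)‖ₑ ^ q := by
        rw [← (Equiv.addRight a).tsum_eq]
        refine tsum_congr fun j => ?_
        simp
    _ ≤ C := by simpa using hC u hu

theorem sampleAxis_grid {n : ℕ} (hn : 1 ≤ n) (i : Fin d) (a : ℤ) {u : ℝ} (hu : u ∈ Set.Icc (0 : ℝ) 1)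
    (g : Torus d → ℂ) (x : Torus d) :
    sampleAxis n i ((gridStep n * (a + u) : ℝ) : AddCircle (2 * Real.pi)) g x =
      ∑' j : ℤ, sampKernel (u - j) * g (x + axis i (gridStep n * a) + axis i (gridStep n * j)) := by
  set c : ℤ → ℂ := fun j => g (x + axis i (gridStep n * j)) with hc
  have hper : ∀ j m : ℤ, c (m * (16 * n : ℕ) + j) = c j := fun j m => by
    simp only [hc, axis_period hn]
  have hcb : ∀ j, ‖c j‖ ≤ ∑ k ∈ Finset.range (16 * n), ‖c k‖ := by
    intro j
    have hN : (0 : ℤ) < (16 * n : ℕ) := by omega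
    have h1 := hper (j % (16 * n : ℕ)) (j / (16 * n : ℕ))
    rw [mul_comm, Int.mul_ediv_add_emod] at h1
    obtain ⟨k, hk⟩ := Int.eq_ofNat_of_zero_le (Int.emod_nonneg j hN.ne')
    have hk2 := Int.emod_lt_of_pos j hN
    rw [h1, hk]
    rw [hk] at hk2
    exact Finset.single_le_sum (f := fun k : ℕ => ‖c k‖) (fun _ _ => norm_nonneg _)
      (Finset.mem_range.2 (by exact_mod_cast hk2))
  have hs0 : Summable fun j : ℤ => ‖sampKernel (u - j)‖ := by
    simpa using summable_sampKernel_mul_pow hu 0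
  have hs : Summable fun j : ℤ => sampKernel (u - (j - a)) * c j := by
    have h2 : Summable fun j : ℤ => ‖sampKernel (u - (j - a))‖ := by
      rw [← (Equiv.addRight a).summable_iff]
      refine hs0.congr fun j => ?_
      simp
    refine Summable.of_norm_bounded (h2.mul_right (∑ k ∈ Finset.range (16 * n), ‖c k‖)) fun j => ?_
    rw [norm_mul]
    gcongr
    exact hcb j
  have h3 := sum_tsum_residue (N := 16 * n) (by omega) hs
  have h4 : ∑' j : ℤ, sampKernel (u - (j - a)) * c j = ∑' j : ℤ, sampKernel (u - j) * c (j + a) := by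
    rw [← (Equiv.addRight a).tsum_eq]
    refine tsum_congr fun j => ?_
    simp
  rw [h4] at h3
  rw [sampleAxis]
  refine Eq.trans (Finset.sum_congr rfl fun j _ => ?_) (h3.trans (tsum_congr fun j => ?_))
  · rw [circKernel_grid hn, ← tsum_mul_right]
    refine tsum_congr fun m => ?_
    rw [hper]
    simp only [hc]
    push_cast
    rfl
  · simp only [hc]
    rw [add_assoc, ← axis_add]
    congr 4
    push_cast
    ring

/-- Sampling in one coordinate approximates `f` up to coordinate differences. -/
theorem exists_sampleAxis_le {p : ℝ≥0∞} (hp : 0 < p) {r : ℕ} (hr : 1 ≤ r) :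
    ∃ C : ℝ≥0, ∀ (f : Torus d → ℂ) (n : ℕ) (W : ℝ≥0∞), 1 ≤ n → MemLp f p volume →
      AxisBound p r (gridStep n) W f → ∀ (i : Fin d) (y : AddCircle (2 * Real.pi)),
      quasi p (fun x => f (x + Pi.single i y) - sampleAxis n i y f x) ≤ C * W := by
  obtain ⟨C, hC⟩ := exists_cell_sampling_le (d := d) hp hr
  refine ⟨C, fun f n W hn hf hW i y => ?_⟩
  obtain ⟨a, u, hu, rfl⟩ := exists_grid_repr hn y
  have hs : 0 ≤ gridStep n := by
    have := Real.pi_pos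
    rw [gridStep]; positivity
  have h := hC (fun x => f (x + axis i (gridStep n * a))) (gridStep n) W hs (memLp_translate hf _)
    (hW.translate hf.1 _) i u hu
  refine le_trans (le_of_eq ?_) h
  congr 1
  funext x
  rw [sampleAxis_grid hn i a hu]
  congr 1
  · rw [add_assoc, ← axis_add, ← mul_add, add_comm u]
    rfl
  · refine tsum_congr fun j => ?_
    rw [add_right_comm]

/-! ### Sampling in all coordinates -/

/-- Iterated sampling in the coordinates of a list. -/
def sampleList (n : ℕ) (y : Torus d) : List (Fin d) → (Torus d → ℂ) → Torus d → ℂ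
  | [], g => g
  | i :: l, g => sampleAxis n i (y i) (sampleList n y l g)

theorem aesm_sampleAxis (n : ℕ) (i : Fin d) (y : AddCircle (2 * Real.pi)) {g : Torus d → ℂ}
    (hg : AEStronglyMeasurable g volume) : AEStronglyMeasurable (sampleAxis n i y g) volume :=
  Finset.aestronglyMeasurable_fun_sum _ fun _ _ => (aesm_translate hg _).const_mul _

theorem aesm_sampleList (n : ℕ) (y : Torus d) (l : List (Fin d)) {g : Torus d → ℂ}
    (hg : AEStronglyMeasurable g volume) : AEStronglyMeasurable (sampleList n y l g) volume := by
  induction l with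
  | nil => exact hg
  | cons i l ih => exact aesm_sampleAxis n i _ ih

theorem exists_quasi_sampleAxis_le {p : ℝ≥0∞} (hp : 0 < p) :
    ∃ C : ℝ≥0, ∀ (n : ℕ), 1 ≤ n → ∀ (i : Fin d) (y : AddCircle (2 * Real.pi)) (g : Torus d → ℂ),
      AEStronglyMeasurable g volume → quasi p (sampleAxis n i y g) ≤ C * quasi p g := by
  obtain ⟨C, hC⟩ := exists_circKernel_sum_le (subExp_pos hp) (subExp_le_one p)
  refine ⟨C, fun n hn i y g hg => ?_⟩
  refine (quasi_sum_le hp _ fun j : ℕ => (aesm_translate hg _).const_mul (circKernel n j y)).trans ?_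
  refine le_trans (le_of_eq ?_) (mul_le_mul_left (hC n hn y) (quasi p g))
  rw [Finset.sum_mul]
  refine Finset.sum_congr rfl fun j _ => ?_
  rw [quasi_const_mul hp, quasi_translate hg]

theorem exists_sampleList_le {p : ℝ≥0∞} (hp : 0 < p) {r : ℕ} (hr : 1 ≤ r) (l : List (Fin d)) :
    ∃ C : ℝ≥0, ∀ (f : Torus d → ℂ) (n : ℕ) (W : ℝ≥0∞), 1 ≤ n → MemLp f p volume →
      AxisBound p r (gridStep n) W f → ∀ y : Torus d,
      quasi p (fun x => f (x + (l.map fun i => Pi.single i (y i)).sum) - sampleList n y l f x)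
        ≤ C * W := by
  obtain ⟨C₁, hC₁⟩ := exists_sampleAxis_le (d := d) hp hr
  obtain ⟨C₂, hC₂⟩ := exists_quasi_sampleAxis_le (d := d) hp
  induction l with
  | nil =>
    refine ⟨0, fun f n W hn hf hW y => ?_⟩
    have : quasi p (fun _ : Torus d => (0 : ℂ)) = 0 := by
      simpa [subExp_pos hp] using quasi_const_mul hp 0 (fun _ : Torus d => (0 : ℂ))
    simp [sampleList, this]
  | cons i l ih =>
    obtain ⟨C₃, hC₃⟩ := ih
    refine ⟨C₁ + C₂ * C₃, fun f n W hn hf hW y => ?_⟩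
    set F : Torus d → ℂ := fun x => f (x + (l.map fun i => Pi.single i (y i)).sum) with hF
    have hFm : AEStronglyMeasurable F volume := aesm_translate hf.1 _
    have hlm := aesm_sampleList n y l hf.1
    have h1 := hC₁ F n W hn (memLp_translate hf _) (hW.translate hf.1 _) i (y i)
    have h2 := (hC₂ n hn i (y i) (fun x => F x - sampleList n y l f x) (hFm.sub hlm)).trans
      (mul_le_mul_right (hC₃ f n W hn hf hW y) _)
    have e : (fun x => f (x + (((i :: l).map fun i => Pi.single i (y i)).sum)) -
        sampleList n y (i :: l) f x) = (fun x => F (x + Pi.single i (y i)) - sampleAxis n i (y i) F x) +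
        sampleAxis n i (y i) (fun x => F x - sampleList n y l f x) := by
      funext x
      simp only [Pi.add_apply, sampleList, sampleAxis, mul_sub, Finset.sum_sub_distrib, hF,
        List.map_cons, List.sum_cons]
      rw [← add_assoc]
      ring
    rw [e, ENNReal.coe_add, ENNReal.coe_mul, add_mul, mul_assoc]
    exact (quasi_add_le hp ((aesm_translate hFm _).sub (aesm_sampleAxis n i _ hFm))
      (aesm_sampleAxis n i _ (hFm.sub hlm))).trans (add_le_add h1 h2)

/-- Sampling on the full grid. -/
def sampleGrid (n : ℕ) (y : Torus d) (f : Torus d → ℂ) : Torus d → ℂ :=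
  sampleList n y (List.finRange d) f

theorem exists_sampleGrid_le (d : ℕ) {p : ℝ≥0∞} (hp : 0 < p) {r : ℕ} (hr : 1 ≤ r) :
    ∃ C : ℝ≥0, ∀ (f : Torus d → ℂ) (n : ℕ) (W : ℝ≥0∞), 1 ≤ n → MemLp f p volume →
      AxisBound p r (gridStep n) W f → ∀ y : Torus d,
      quasi p (fun x => f (x + y) - sampleGrid n y f x) ≤ C * W := by
  obtain ⟨C, hC⟩ := exists_sampleList_le (d := d) hp hr (List.finRange d)
  refine ⟨C, fun f n W hn hf hW y => ?_⟩
  have h := hC f n W hn hf hW y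
  rw [← List.ofFn_eq_map, List.sum_ofFn, Finset.univ_sum_single] at h
  exact h

/-! ### Trigonometric polynomials and averaging over the position of the grid -/

theorem expChar_add (k : Fin d → ℤ) (x y : Torus d) :
    expChar k (x + y) = expChar k x * expChar k y := by
  simp only [expChar, Pi.add_apply, ← Finset.prod_mul_distrib]
  refine Finset.prod_congr rfl fun j _ => ?_
  simp [fourier_apply, smul_add, AddCircle.toCircle_add]

theorem expChar_add_index (k l : Fin d → ℤ) (x : Torus d) :
    expChar (k + l) x = expChar k x * expChar l x := by
  simp only [expChar, Pi.add_apply, ← Finset.prod_mul_distrib]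
  exact Finset.prod_congr rfl fun j _ => fourier_add

theorem expChar_single (i : Fin d) (m : ℤ) (x : Torus d) :
    expChar (Pi.single i m) x = fourier m (x i) := by
  rw [expChar, Finset.prod_eq_single i]
  · simp
  · intro j _ hj
    simp [hj]
  · simp

theorem continuous_expChar (k : Fin d → ℤ) : Continuous (expChar k) :=
  continuous_finsetProd _ fun j _ => (fourier (k j)).continuous.comp (continuous_apply j)

theorem trigPoly_translate {n : ℕ} {T : Torus d → ℂ} (hT : T ∈ trigPoly d n) (y : Torus d) :
    (fun x => T (x + y)) ∈ trigPoly d n := by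
  induction hT using Submodule.span_induction with
  | mem T h =>
    obtain ⟨k, hk, rfl⟩ := h
    have : (fun x => expChar k (x + y)) = expChar k y • expChar k := by
      funext x
      simp [expChar_add, mul_comm]
    rw [this]
    exact Submodule.smul_mem _ _ (Submodule.subset_span ⟨k, hk, rfl⟩)
  | zero => exact Submodule.zero_mem _
  | add f g _ _ hf hg => exact Submodule.add_mem _ hf hg
  | smul c f _ hf => exact Submodule.smul_mem _ c hf

/-- Trigonometric polynomials of degree at most `n` in the coordinates of a list. -/
def trigPolyOn (d n : ℕ) (l : List (Fin d)) : Submodule ℂ (Torus d → ℂ) :=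
  Submodule.span ℂ (expChar '' {k : Fin d → ℤ | (∀ j, |k j| ≤ (n : ℤ)) ∧ ∀ j, j ∉ l → k j = 0})

theorem circKernel_mul_mem {n : ℕ} {l : List (Fin d)} {i : Fin d} (hi : i ∉ l) (j : ℤ)
    {h : Torus d → ℂ} (hh : h ∈ trigPolyOn d n l) :
    (fun y => circKernel n j (y i) * h y) ∈ trigPolyOn d n (i :: l) := by
  induction hh using Submodule.span_induction with
  | mem h hk =>
    obtain ⟨k, ⟨hk1, hk2⟩, rfl⟩ := hk
    have : (fun y : Torus d => circKernel n j (y i) * expChar k y) =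
        ∑ m ∈ Finset.Icc (-(n : ℤ)) n, (((16 * n : ℝ) : ℂ)⁻¹ * freqBumpS (m / (16 * n)) *
          fourier (-m) ((j / (16 * n) : ℝ) : UnitAddCircle)) • expChar (Pi.single i m + k) := by
      funext y
      simp only [circKernel, Finset.sum_mul, Finset.sum_apply, Pi.smul_apply, smul_eq_mul,
        expChar_add_index, expChar_single]
      refine Finset.sum_congr rfl fun m _ => by ring
    rw [this]
    refine Submodule.sum_mem _ fun m hm => Submodule.smul_mem _ _ (Submodule.subset_span ⟨_, ⟨?_, ?_⟩, rfl⟩)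
    · intro a
      rcases eq_or_ne a i with rfl | ha
      · simp only [Pi.add_apply, Pi.single_eq_same, hk2 a hi, add_zero]
        exact abs_le.2 (Finset.mem_Icc.1 hm)
      · simp only [Pi.add_apply, Pi.single_eq_of_ne ha, zero_add]
        exact hk1 a
    · intro a ha
      rw [List.mem_cons, not_or] at ha
      simp [Pi.single_eq_of_ne ha.1, hk2 a ha.2]
  | zero =>
    have e : (fun y : Torus d => circKernel n j (y i) * (0 : Torus d → ℂ) y) = 0 := by
      funext y
      simp
    rw [e]
    exact Submodule.zero_mem _
  | add f g _ _ hf hg =>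
    have := Submodule.add_mem _ hf hg
    simpa [Pi.add_def, mul_add] using this
  | smul c f _ hf =>
    have := Submodule.smul_mem _ c hf
    have e : (fun y : Torus d => circKernel n j (y i) * (c • f) y) =
        c • fun y => circKernel n j (y i) * f y := by
      funext y
      simp only [Pi.smul_apply, smul_eq_mul]
      ring
    rw [e]
    exact this

theorem sampleList_mem (n : ℕ) (g : Torus d → ℂ) {l : List (Fin d)} (hl : l.Nodup) (x : Torus d) :
    (fun y => sampleList n y l g x) ∈ trigPolyOn d n l := by
  induction l generalizing x with
  | nil =>
    have : (fun y : Torus d => sampleList n y [] g x) = g x • expChar 0 := by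
      funext y
      simp [sampleList, expChar]
    rw [this]
    exact Submodule.smul_mem _ _ (Submodule.subset_span ⟨0, ⟨by simp, by simp⟩, rfl⟩)
  | cons i l ih =>
    rw [List.nodup_cons] at hl
    have e : (fun y : Torus d => sampleList n y (i :: l) g x) = ∑ j ∈ Finset.range (16 * n),
        fun y => circKernel n j (y i) * sampleList n y l g (x + axis i (gridStep n * j)) := by
      funext y
      simp [sampleList, sampleAxis]
    rw [e]
    exact Submodule.sum_mem _ fun j _ => circKernel_mul_mem hl.1 j (ih hl.2 _)

theorem sampleGrid_mem (n : ℕ) (g : Torus d → ℂ) (x : Torus d) :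
    (fun y => sampleGrid n y g x) ∈ trigPoly d n := by
  refine Submodule.span_mono (Set.image_mono ?_) (sampleList_mem n g (List.nodup_finRange d) x)
  exact fun k hk => hk.1

theorem continuous_circKernel (n : ℕ) (j : ℤ) : Continuous (circKernel n j) :=
  continuous_finsetSum _ fun m _ => continuous_const.mul (fourier m).continuous

theorem measurable_sampleList (n : ℕ) {g : Torus d → ℂ} (hg : Measurable g) (l : List (Fin d)) :
    Measurable fun z : Torus d × Torus d => sampleList n z.1 l g z.2 := by
  induction l with
  | nil => exact hg.comp measurable_snd
  | cons i l ih =>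
    simp only [sampleList, sampleAxis]
    refine Finset.measurable_fun_sum _ fun j _ => Measurable.mul ?_ ?_
    · exact (continuous_circKernel n j).measurable.comp ((measurable_pi_apply i).comp measurable_fst)
    · exact ih.comp (measurable_fst.prodMk (measurable_snd.add_const _))

theorem volume_torus_ne_zero : (volume : Measure (Torus d)) ≠ 0 :=
  NeZero.ne _

/-- If the approximants `G y` to the translates of `f` are trigonometric polynomials in the
translation vector `y`, then for a suitable base point `z` the function `x ↦ G (x - z) z` is a
trigonometric polynomial approximating `f` at least as well. -/
theorem exists_trigPoly_of_translates {p : ℝ≥0∞} (hp : 0 < p) {n : ℕ} {f : Torus d → ℂ}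
    (hf : Measurable f) {G : Torus d → Torus d → ℂ}
    (hG : Measurable fun z : Torus d × Torus d => G z.1 z.2)
    (hGT : ∀ x, (fun y => G y x) ∈ trigPoly d n) {B : ℝ≥0∞}
    (hB : ∀ y, eLpNorm (fun x => f (x + y) - G y x) p volume ≤ B) :
    ∃ T ∈ trigPoly d n, eLpNorm (f - T) p volume ≤ B := by
  set H : Torus d × Torus d → ℂ := fun z => f (z.2 + z.1) - G z.1 z.2 with hH
  have hHm : Measurable H := (hf.comp (measurable_snd.add measurable_fst)).sub hG
  have hT : ∀ z : Torus d, (fun x => G (x - z) z) ∈ trigPoly d n := fun z => by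
    simpa [sub_eq_add_neg] using trigPoly_translate (hGT z) (-z)
  suffices h : ∃ z : Torus d, eLpNorm (fun x => H (x - z, z)) p volume ≤ B by
    obtain ⟨z, hz⟩ := h
    refine ⟨_, hT z, le_trans (le_of_eq ?_) hz⟩
    congr 1
    funext x
    simp [hH]
  -- after the substitution `y = x - z` these are the sections of `H` at `z`, and `hB` bounds the
  -- sections in the other variable
  rcases eq_or_ne p ∞ with rfl | hpt
  · have h1 : ∀ᵐ y : Torus d, ∀ᵐ x : Torus d, ‖H (y, x)‖ₑ ≤ B := by
      refine Filter.Eventually.of_forall fun y => ?_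
      filter_upwards [enorm_ae_le_eLpNormEssSup (fun x => f (x + y) - G y x) volume] with x hx
      refine hx.trans ?_
      simpa using hB y
    have h2 : MeasurableSet {z : Torus d × Torus d | ‖H z‖ₑ ≤ B} :=
      measurableSet_le hHm.enorm measurable_const
    have h3 := (Measure.ae_ae_comm (p := fun y x : Torus d => ‖H (y, x)‖ₑ ≤ B) h2).1 h1
    have : (ae (volume : Measure (Torus d))).NeBot := ae_neBot.2 volume_torus_ne_zero
    obtain ⟨z, hz⟩ := h3.exists
    refine ⟨z, ?_⟩
    rw [eLpNorm_exponent_top]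
    refine eLpNormEssSup_le_of_ae_enorm_bound ?_
    exact (measurePreserving_sub_right volume z).quasiMeasurePreserving.ae hz
  · have hp0 : 0 < p.toReal := ENNReal.toReal_pos hp.ne' hpt
    have key : ∀ F : Torus d → ℂ, eLpNorm F p volume ≤ B ↔ ∫⁻ x, ‖F x‖ₑ ^ p.toReal ≤ B ^ p.toReal :=
      fun F => by
        rw [eLpNorm_eq_lintegral_rpow_enorm_toReal hp.ne' hpt, one_div, ENNReal.rpow_inv_le_iff hp0]
    have hmeas : Measurable fun z : Torus d × Torus d => ‖H z‖ₑ ^ p.toReal :=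
      hHm.enorm.pow_const _
    have h1 : ∀ z : Torus d, ∫⁻ x, ‖H (x - z, z)‖ₑ ^ p.toReal = ∫⁻ y, ‖H (y, z)‖ₑ ^ p.toReal :=
      fun z => lintegral_sub_right_eq_self (fun y => ‖H (y, z)‖ₑ ^ p.toReal) z
    obtain ⟨z, hz⟩ := exists_le_laverage (volume_torus_ne_zero (d := d))
      (f := fun z => ∫⁻ y, ‖H (y, z)‖ₑ ^ p.toReal) hmeas.lintegral_prod_left'.aemeasurable
    refine ⟨z, (key _).2 ?_⟩
    rw [h1]
    refine hz.trans ?_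
    rw [laverage_eq]
    refine ENNReal.div_le_of_le_mul ?_
    rw [lintegral_lintegral_swap]
    · calc _ ≤ ∫⁻ _ : Torus d, B ^ p.toReal := lintegral_mono fun y => (key _).1 (hB y)
        _ = _ := by simp
    · exact (hmeas.comp measurable_swap).aemeasurable

/-- **Jackson's inequality** for moduli of smoothness of integer order, in terms of coordinate
differences. -/
theorem exists_jackson (d : ℕ) {p : ℝ≥0∞} (hp : 0 < p) {r : ℕ} (hr : 1 ≤ r) :
    ∃ C : ℝ≥0, ∀ (f : Torus d → ℂ) (n : ℕ) (W : ℝ≥0∞), 1 ≤ n → MemLp f p volume →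
      AxisBound p r (gridStep n) W f →
      ∃ T ∈ trigPoly d n, quasi p (f - T) ≤ C * W := by
  obtain ⟨C, hC⟩ := exists_sampleGrid_le d hp hr
  refine ⟨C, fun f n W hn hf hW => ?_⟩
  set g : Torus d → ℂ := hf.1.mk f with hg
  have hgm : Measurable g := hf.1.stronglyMeasurable_mk.measurable
  have hfg : f =ᵐ[volume] g := hf.1.ae_eq_mk
  have hgp : MemLp g p volume := (memLp_congr_ae hfg).1 hf
  have hae : ∀ h r, (fwdDiff h)^[r] f =ᵐ[volume] (fwdDiff h)^[r] g := by
    intro h r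
    induction r with
    | zero => exact hfg
    | succ r ih =>
      rw [Function.iterate_succ_apply', Function.iterate_succ_apply']
      have := (measurePreserving_translate h).quasiMeasurePreserving.ae_eq_comp ih
      filter_upwards [ih, this] with x h1 h2
      simp only [Function.comp_apply] at h2
      simp [fwdDiff, h1, h2]
  have hWg : AxisBound p r (gridStep n) W g := fun i t ht => by
    rw [← quasi_congr_ae (hae _ _)]
    exact hW i t ht
  have hq := subExp_pos hp
  obtain ⟨T, hT, hTB⟩ := exists_trigPoly_of_translates hp (n := n) hgm
    (G := fun y x => sampleGrid n y g x) (measurable_sampleList n hgm _) (sampleGrid_mem n g)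
    (B := (C * W) ^ (subExp p)⁻¹) fun y => (ENNReal.le_rpow_inv_iff hq).2 (hC g n W hn hgp hWg y)
  refine ⟨T, hT, ?_⟩
  have : quasi p (f - T) = quasi p (g - T) := quasi_congr_ae (by
    filter_upwards [hfg] with x hx
    simp [hx])
  rw [this]
  exact (ENNReal.le_rpow_inv_iff hq).1 hTB

/-! ### Generalized binomial coefficients -/

theorem binom_succ (α : ℝ) (ν : ℕ) : binom α (ν + 1) = binom α ν * ((α - ν) / (ν + 1)) := by
  rw [binom, binom, Finset.prod_range_succ, Nat.factorial_succ]
  have : (ν.factorial : ℝ) ≠ 0 := by positivity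
  push_cast
  field_simp

theorem binom_eq_choose (α : ℝ) (ν : ℕ) : binom α ν = Ring.choose α ν := by
  have h : (descPochhammer ℤ ν).smeval α = ∏ j ∈ Finset.range ν, (α - j) := by
    induction ν with
    | zero => simp
    | succ ν ih =>
      rw [Finset.prod_range_succ, ← ih, descPochhammer_succ_right, Polynomial.smeval_mul]
      simp [Polynomial.smeval_natCast]
  rw [binom, Ring.choose_eq_smul, h, smul_eq_mul, div_eq_inv_mul]

theorem binom_natCast (r ν : ℕ) : binom r ν = r.choose ν := by
  rw [binom_eq_choose, Ring.choose_natCast]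

/-- Vandermonde's identity. -/
theorem binom_add (α γ : ℝ) (k : ℕ) :
    binom (α + γ) k = ∑ ij ∈ Finset.HasAntidiagonal.antidiagonal k, binom α ij.1 * binom γ ij.2 := by
  simp only [binom_eq_choose]
  exact Ring.add_choose_eq k (Commute.all _ _)

/-- The coefficients decay like `ν ^ (-1 - α)`. -/
theorem exists_binom_le {α : ℝ} (hα : 0 < α) :
    ∃ C : ℝ, ∀ ν : ℕ, 1 ≤ ν → |binom α ν| ≤ C * (ν : ℝ) ^ (-(1 + α)) := by
  obtain ⟨N, hN⟩ := exists_nat_ge α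
  have hmono : ∀ ν : ℕ, N + 1 ≤ ν →
      |binom α ν| * (ν : ℝ) ^ (1 + α) ≤ |binom α (N + 1)| * ((N + 1 : ℕ) : ℝ) ^ (1 + α) := by
    intro ν hν
    induction ν, hν using Nat.le_induction with
    | base => exact le_rfl
    | succ ν hν ih =>
      refine le_trans ?_ ih
      have hν0 : (0 : ℝ) < ν := by exact_mod_cast (by omega : 0 < ν)
      have hαν : α ≤ ν := hN.trans (by exact_mod_cast (by omega : N ≤ ν))
      rw [binom_succ, abs_mul, mul_assoc]
      refine mul_le_mul_of_nonneg_left ?_ (abs_nonneg _)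
      have h1 : |(α - ν) / ((ν : ℝ) + 1)| = (ν - α) / (ν + 1) := by
        rw [abs_div, abs_of_nonpos (by linarith), abs_of_pos (by positivity)]
        ring
      -- Bernoulli's inequality
      have h2 : 1 + (1 + α) * (-1 / ((ν : ℝ) + 1)) ≤ (1 + -1 / ((ν : ℝ) + 1)) ^ (1 + α) :=
        one_add_mul_self_le_rpow_one_add
          (by rw [le_div_iff₀ (by positivity)]; linarith) (by linarith)
      have h3 : 1 + (1 + α) * (-1 / ((ν : ℝ) + 1)) = (ν - α) / (ν + 1) := by
        field_simp
        ring
      have h4 : (1 + -1 / ((ν : ℝ) + 1)) = ν / (ν + 1) := by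
        field_simp
        ring
      rw [h1, ← h3]
      push_cast
      calc _ ≤ ((ν : ℝ) / (ν + 1)) ^ (1 + α) * ((ν : ℝ) + 1) ^ (1 + α) := by
            rw [← h4]
            gcongr
        _ = (ν : ℝ) ^ (1 + α) := by
            rw [← Real.mul_rpow (by positivity) (by positivity)]
            congr 1
            field_simp
  refine ⟨∑ ν ∈ Finset.range (N + 2), |binom α ν| * (ν : ℝ) ^ (1 + α), fun ν hν => ?_⟩
  have hν0 : (0 : ℝ) < ν := by exact_mod_cast hν
  rw [Real.rpow_neg hν0.le, ← div_eq_mul_inv, le_div_iff₀ (by positivity)]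
  have hs : ∀ μ < N + 2, |binom α μ| * (μ : ℝ) ^ (1 + α)
      ≤ ∑ ν ∈ Finset.range (N + 2), |binom α ν| * (ν : ℝ) ^ (1 + α) := fun μ hμ =>
    Finset.single_le_sum (f := fun ν : ℕ => |binom α ν| * (ν : ℝ) ^ (1 + α))
      (fun _ _ => by positivity) (Finset.mem_range.2 hμ)
  rcases lt_or_ge ν (N + 2) with h | h
  · exact hs ν h
  · exact (hmono ν (by omega)).trans (hs (N + 1) (by omega))

theorem summable_binom_rpow {α q : ℝ} (hα : 0 < α) (hq : 0 < q) (h : 1 < (1 + α) * q) :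
    Summable fun ν : ℕ => |binom α ν| ^ q := by
  obtain ⟨C, hC⟩ := exists_binom_le hα
  have hs : Summable fun ν : ℕ => C ^ q * (ν : ℝ) ^ (-((1 + α) * q)) :=
    (Real.summable_nat_rpow.2 (by linarith)).mul_left _
  refine Summable.of_norm_bounded_eventually_nat hs ?_
  filter_upwards [Filter.eventually_ge_atTop 1] with ν hν
  have hν0 : (0 : ℝ) < ν := by exact_mod_cast hν
  have hC0 : 0 ≤ C := by
    have h1 := (abs_nonneg _).trans (hC 1 le_rfl)
    simpa using h1
  rw [Real.norm_of_nonneg (by positivity)]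
  calc |binom α ν| ^ q ≤ (C * (ν : ℝ) ^ (-(1 + α))) ^ q :=
        Real.rpow_le_rpow (abs_nonneg _) (hC ν hν) hq.le
    _ = C ^ q * (ν : ℝ) ^ (-((1 + α) * q)) := by
        rw [Real.mul_rpow hC0 (by positivity), ← Real.rpow_mul hν0.le]
        ring_nf

theorem summable_binom_natCast_rpow {q : ℝ} (hq : 0 < q) (r : ℕ) :
    Summable fun ν : ℕ => |binom r ν| ^ q := by
  refine summable_of_ne_finset_zero (s := Finset.range (r + 1)) fun ν hν => ?_
  rw [binom_natCast, Nat.choose_eq_zero_of_lt (by simpa using hν)]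
  simp [hq.ne']

theorem Admissible.pos {p : ℝ≥0∞} {α : ℝ} (h : Admissible p α) : 0 < α := by
  rcases h with ⟨r, hr, rfl⟩ | h
  · exact_mod_cast hr
  · exact lt_of_le_of_lt (le_max_right _ _) h

theorem one_lt_mul_subExp {p : ℝ≥0∞} (hp : 0 < p) {α : ℝ}
    (h : max (p⁻¹.toReal - 1) 0 < α) : 1 < (1 + α) * subExp p := by
  have hα : 0 < α := lt_of_le_of_lt (le_max_right _ _) h
  rcases le_total p 1 with h1 | h1
  · have hp0 : 0 < p.toReal := ENNReal.toReal_pos hp.ne' (ne_top_of_le_ne_top ENNReal.one_ne_top h1)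
    have h2 := lt_of_le_of_lt (le_max_left _ _) h
    rw [ENNReal.toReal_inv] at h2
    rw [subExp_of_le_one h1]
    have h3 : p.toReal⁻¹ * p.toReal < (1 + α) * p.toReal := by gcongr; linarith
    rwa [inv_mul_cancel₀ hp0.ne'] at h3
  · rw [subExp_of_one_le h1]
    linarith

theorem Admissible.summable_binom {p : ℝ≥0∞} (hp : 0 < p) {α : ℝ} (h : Admissible p α) :
    Summable fun ν : ℕ => |binom α ν| ^ subExp p := by
  have hα := h.pos
  rcases h with ⟨r, _, rfl⟩ | h
  · exact summable_binom_natCast_rpow (subExp_pos hp) r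
  · exact summable_binom_rpow hα (subExp_pos hp) (one_lt_mul_subExp hp h)

theorem summable_abs_binom {α : ℝ} (hα : 0 < α) : Summable fun ν : ℕ => |binom α ν| := by
  simpa using summable_binom_rpow hα one_pos (by linarith)

/-- The sum of the `min(1, p)`-th powers of the generalized binomial coefficients. -/
def binomSum (p : ℝ≥0∞) (α : ℝ) : ℝ≥0∞ := ∑' ν : ℕ, ‖binom α ν‖ₑ ^ subExp p

theorem Admissible.binomSum_ne_top {p : ℝ≥0∞} (hp : 0 < p) {α : ℝ} (h : Admissible p α) :
    binomSum p α ≠ ∞ := by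
  have h1 := (h.summable_binom hp).tsum_ofReal_ne_top
  have h2 : ∀ ν, ENNReal.ofReal (|binom α ν| ^ subExp p) = ‖binom α ν‖ₑ ^ subExp p := fun ν => by
    rw [← ENNReal.ofReal_rpow_of_nonneg (abs_nonneg _) (subExp_pos hp).le, Real.enorm_eq_ofReal_abs]
  rw [binomSum]
  simpa only [h2] using h1

/-! ### The binomial series on the closed disc -/

theorem continuousOn_one_add_cpow {α : ℝ} (hα : 0 < α) :
    ContinuousOn (fun z : ℂ => (1 + z) ^ (α : ℂ)) (Metric.closedBall 0 1) := by
  intro z hz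
  have hre : 0 ≤ (1 + z).re := by
    have h1 := Complex.abs_re_le_norm z
    have h2 : ‖z‖ ≤ 1 := by simpa using hz
    have := (abs_le.1 (h1.trans h2)).1
    simp only [Complex.add_re, Complex.one_re]
    linarith
  refine ContinuousAt.continuousWithinAt ?_
  have hc : ContinuousAt (fun w : ℂ => w ^ (α : ℂ)) (1 + z) := by
    rcases eq_or_ne (1 + z) 0 with h0 | h0
    · rw [h0]
      have := Complex.continuousAt_cpow_zero_of_re_pos (z := (α : ℂ)) (by simpa using hα)
      exact this.comp (f := fun w : ℂ => (w, (α : ℂ))) (by fun_prop)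
    · refine continuousAt_cpow_const ?_
      rw [Complex.mem_slitPlane_iff]
      rcases hre.lt_or_eq with h | h
      · exact Or.inl h
      · exact Or.inr fun him => h0 (Complex.ext h.symm him)
  exact hc.comp (f := fun w : ℂ => 1 + w) (by fun_prop)

theorem hasSum_binom_mul_pow {α : ℝ} (hα : 0 < α) {z : ℂ} (hz : ‖z‖ ≤ 1) :
    HasSum (fun ν : ℕ => (binom α ν : ℂ) * z ^ ν) ((1 + z) ^ (α : ℂ)) := by
  have hb : ∀ (ν : ℕ), ∀ z ∈ Metric.closedBall (0 : ℂ) 1, ‖(binom α ν : ℂ) * z ^ ν‖ ≤ |binom α ν| := by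
    intro ν z hz
    rw [norm_mul, norm_pow, Complex.norm_real, Real.norm_eq_abs]
    exact mul_le_of_le_one_right (abs_nonneg _) (pow_le_one₀ (norm_nonneg _) (by simpa using hz))
  have hs := summable_abs_binom hα
  have hcont : ContinuousOn (fun z : ℂ => ∑' ν : ℕ, (binom α ν : ℂ) * z ^ ν) (Metric.closedBall 0 1) :=
    continuousOn_tsum (fun ν => by fun_prop) hs hb
  have heq : Set.EqOn (fun z : ℂ => ∑' ν : ℕ, (binom α ν : ℂ) * z ^ ν)
      (fun z : ℂ => (1 + z) ^ (α : ℂ)) (Metric.ball 0 1) := by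
    intro z hz
    have h := (Complex.one_add_cpow_hasFPowerSeriesOnBall_zero (a := (α : ℂ))).hasSum (y := z)
      (by simpa [← ENNReal.ofReal_one, Metric.eball_ofReal] using hz)
    rw [zero_add] at h
    refine Eq.trans ?_ h.tsum_eq
    refine tsum_congr fun ν => ?_
    rw [binom_eq_choose, Complex.ofReal_choose]
    simp [binomialSeries, FormalMultilinearSeries.coeff_ofScalars, mul_comm]
  have heq2 := heq.of_subset_closure hcont (continuousOn_one_add_cpow hα)
    Metric.ball_subset_closedBall (by rw [closure_ball _ one_ne_zero])
  have hzm : z ∈ Metric.closedBall (0 : ℂ) 1 := by simpa using hz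
  have hsum : Summable fun ν : ℕ => (binom α ν : ℂ) * z ^ ν :=
    Summable.of_norm_bounded hs fun ν => hb ν z hzm
  have := hsum.hasSum
  rwa [show ∑' ν : ℕ, (binom α ν : ℂ) * z ^ ν = (1 + z) ^ (α : ℂ) from heq2 hzm] at this

/-! ### Multipliers of trigonometric polynomials as sums of translates -/

/-- The pairing `(k, ξ)`. -/
def dot (k : Fin d → ℤ) (ξ : EuclideanSpace ℝ (Fin d)) : ℝ := ∑ j, (k j : ℝ) * ξ j

theorem dot_smul (k : Fin d → ℤ) (c : ℝ) (ξ : EuclideanSpace ℝ (Fin d)) :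
    dot k (c • ξ) = c * dot k ξ := by
  rw [dot, dot, Finset.mul_sum]
  refine Finset.sum_congr rfl fun j _ => ?_
  simp only [PiLp.smul_apply, smul_eq_mul]
  ring

theorem mk_add (v w : EuclideanSpace ℝ (Fin d)) : Torus.mk (v + w) = Torus.mk v + Torus.mk w := by
  funext j
  simp [Torus.mk]

theorem expChar_mk (k : Fin d → ℤ) (v : EuclideanSpace ℝ (Fin d)) :
    expChar k (Torus.mk v) = Complex.exp (Complex.I * dot k v) := by
  rw [expChar, dot, Complex.ofReal_sum, Finset.mul_sum, Complex.exp_sum]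
  refine Finset.prod_congr rfl fun j _ => ?_
  rw [Torus.mk, fourier_coe_apply]
  congr 1
  have hpi : (Real.pi : ℂ) ≠ 0 := by exact_mod_cast Real.pi_ne_zero
  push_cast
  field_simp

/-- The set of frequencies `k` with `|k|_∞ ≤ n`. -/
def freqBox (d n : ℕ) : Finset (Fin d → ℤ) := Fintype.piFinset fun _ => Finset.Icc (-(n : ℤ)) n

theorem mem_freqBox {n : ℕ} {k : Fin d → ℤ} : k ∈ freqBox d n ↔ ∀ j, |k j| ≤ (n : ℤ) := by
  simp [freqBox, abs_le]

/-- The trigonometric polynomial with the coefficients `c k`, `|k|_∞ ≤ n`. -/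
def trigSum (n : ℕ) (c : (Fin d → ℤ) → ℂ) (x : Torus d) : ℂ :=
  ∑ k ∈ freqBox d n, c k * expChar k x

theorem exists_eq_trigSum {n : ℕ} {T : Torus d → ℂ} (hT : T ∈ trigPoly d n) :
    ∃ c, T = trigSum n c := by
  have hset : {k : Fin d → ℤ | ∀ j, |k j| ≤ (n : ℤ)} = (freqBox d n : Set (Fin d → ℤ)) := by
    ext k
    simp [mem_freqBox]
  rw [trigPoly, hset, Submodule.mem_span_image_finset_iff_exists_fun'] at hT
  obtain ⟨c, hc⟩ := hT
  refine ⟨c, ?_⟩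
  rw [← hc]
  funext x
  simp [trigSum]

theorem continuous_trigSum (n : ℕ) (c : (Fin d → ℤ) → ℂ) : Continuous (trigSum n c) :=
  continuous_finsetSum _ fun k _ => continuous_const.mul (continuous_expChar k)

theorem memLp_trigSum (p : ℝ≥0∞) (n : ℕ) (c : (Fin d → ℤ) → ℂ) :
    MemLp (trigSum n c) p volume := by
  obtain ⟨C, hC⟩ := isCompact_univ.exists_bound_of_continuousOn
    (continuous_trigSum (d := d) n c).continuousOn
  exact MemLp.of_bound (continuous_trigSum n c).aestronglyMeasurable C
    (Filter.Eventually.of_forall fun x => hC x (Set.mem_univ x))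

theorem tsum_translate_trigSum {ι : Type*} {n : ℕ} (c : (Fin d → ℤ) → ℂ) {a : ι → ℂ}
    {y : ι → EuclideanSpace ℝ (Fin d)} {m : (Fin d → ℤ) → ℂ}
    (hm : ∀ k ∈ freqBox d n, HasSum (fun i => a i * Complex.exp (Complex.I * dot k (y i))) (m k))
    (x : Torus d) :
    ∑' i, a i * trigSum n c (x + Torus.mk (y i)) = trigSum n (fun k => m k * c k) x := by
  have h := hasSum_sum (s := freqBox d n) fun k hk => (hm k hk).mul_right (c k * expChar k x)
  have e : (fun i => a i * trigSum n c (x + Torus.mk (y i))) = fun i => ∑ k ∈ freqBox d n,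
      a i * Complex.exp (Complex.I * dot k (y i)) * (c k * expChar k x) := by
    funext i
    rw [trigSum, Finset.mul_sum]
    refine Finset.sum_congr rfl fun k _ => ?_
    rw [expChar_add, expChar_mk]
    ring
  rw [e, h.tsum_eq, trigSum]
  exact Finset.sum_congr rfl fun k _ => by ring

theorem quasi_trigSum_le {ι : Type*} [Countable ι] {p : ℝ≥0∞} (hp : 0 < p) {n : ℕ}
    (c : (Fin d → ℤ) → ℂ) {a : ι → ℂ} {y : ι → EuclideanSpace ℝ (Fin d)} {m : (Fin d → ℤ) → ℂ}
    (hm : ∀ k ∈ freqBox d n, HasSum (fun i => a i * Complex.exp (Complex.I * dot k (y i))) (m k)) :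
    quasi p (trigSum n fun k => m k * c k) ≤ (∑' i, ‖a i‖ₑ ^ subExp p) * quasi p (trigSum n c) := by
  rw [← funext (tsum_translate_trigSum c hm)]
  exact quasi_tsum_translate_le hp (continuous_trigSum n c).aestronglyMeasurable a _

theorem integral_fourier_eq (m : ℤ) :
    ∫ x : AddCircle (2 * Real.pi), fourier m x = if m = 0 then ((2 * Real.pi : ℝ) : ℂ) else 0 := by
  have h := fourierCoeff_fourier (T := 2 * Real.pi) m
  have h2 := congrFun h 0
  rw [fourierCoeff, AddCircle.integral_haarAddCircle] at h2
  have h3 : (2 * Real.pi : ℝ) ≠ 0 := Real.two_pi_pos.ne'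
  simp only [neg_zero, fourier_zero, one_smul] at h2
  rw [inv_smul_eq_iff₀ h3] at h2
  rw [h2]
  by_cases hm : m = 0
  · subst hm
    simp
  · simp [hm, Ne.symm hm]

theorem integral_expChar (k : Fin d → ℤ) :
    ∫ x : Torus d, expChar k x = if k = 0 then ((2 * Real.pi : ℝ) : ℂ) ^ d else 0 := by
  simp only [expChar]
  rw [integral_fintype_prod_volume_eq_prod (fun j (x : AddCircle (2 * Real.pi)) => fourier (k j) x)]
  simp only [integral_fourier_eq]
  split_ifs with h
  · simp [h]
  · obtain ⟨j, hj⟩ := Function.ne_iff.1 h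
    exact Finset.prod_eq_zero (Finset.mem_univ j) (by simpa using hj)

theorem fourierCoef_trigSum (n : ℕ) (c : (Fin d → ℤ) → ℂ) (l : Fin d → ℤ) :
    fourierCoef (trigSum n c) l = if l ∈ freqBox d n then c l else 0 := by
  have hpi : ((2 * Real.pi : ℝ) : ℂ) ≠ 0 := by exact_mod_cast Real.two_pi_pos.ne'
  have h1 : ∀ x : Torus d, trigSum n c x * expChar (-l) x
      = ∑ k ∈ freqBox d n, c k * expChar (k + -l) x := fun x => by
    rw [trigSum, Finset.sum_mul]
    exact Finset.sum_congr rfl fun k _ => by rw [expChar_add_index, mul_assoc]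
  rw [fourierCoef]
  simp_rw [h1]
  rw [integral_finsetSum]
  · simp_rw [integral_const_mul, integral_expChar, add_neg_eq_zero]
    simp only [mul_ite, mul_zero, Finset.sum_ite_eq']
    split_ifs
    · rw [mul_comm (c l), ← mul_assoc, ← mul_pow, inv_mul_cancel₀ hpi, one_pow, one_mul]
    · rfl
  · intro k _
    exact ((continuous_expChar _).integrable_of_hasCompactSupport
      (HasCompactSupport.of_compactSpace _)).const_mul _

theorem dirDeriv_trigSum (α : ℝ) (ξ : EuclideanSpace ℝ (Fin d)) (n : ℕ) (c : (Fin d → ℤ) → ℂ) :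
    dirDeriv α ξ (trigSum n c)
      = trigSum n fun k => (Complex.I * (dot k ξ : ℂ)) ^ (α : ℂ) * c k := by
  funext x
  rw [dirDeriv, tsum_eq_sum (s := freqBox d n)]
  · refine Finset.sum_congr rfl fun k hk => ?_
    rw [fourierCoef_trigSum, if_pos hk]
    rfl
  · intro k hk
    rw [fourierCoef_trigSum, if_neg hk]
    simp

/-- The multiplier `e^{iαt} (1 - e^{-it})^α` of the difference of order `α`, at `t = (k, h)`. -/
def diffMult (α t : ℝ) : ℂ :=
  Complex.exp (Complex.I * (α * t : ℝ)) * (1 + -Complex.exp (-(Complex.I * t))) ^ (α : ℂ)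

theorem norm_exp_I_mul (t : ℝ) : ‖Complex.exp (Complex.I * t)‖ = 1 := by
  rw [mul_comm, Complex.norm_exp_ofReal_mul_I]

theorem norm_exp_neg_I_mul (t : ℝ) : ‖Complex.exp (-(Complex.I * t))‖ = 1 := by
  have := norm_exp_I_mul (-t)
  simpa using this

theorem hasSum_diffMult {α : ℝ} (hα : 0 < α) (t : ℝ) :
    HasSum (fun ν : ℕ => (((-1) ^ ν * binom α ν : ℝ) : ℂ) * Complex.exp (Complex.I * ((α - ν) * t : ℝ)))
      (diffMult α t) := by
  have h := (hasSum_binom_mul_pow hα (z := -Complex.exp (-(Complex.I * t)))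
    (by rw [norm_neg, norm_exp_neg_I_mul])).mul_left (Complex.exp (Complex.I * (α * t : ℝ)))
  refine Eq.mp (congrArg (fun F : ℕ → ℂ => HasSum F (diffMult α t)) (funext fun ν => ?_)) h
  have h2 : Complex.exp (Complex.I * ((α - ν) * t : ℝ))
      = Complex.exp (Complex.I * (α * t : ℝ)) * Complex.exp (-(Complex.I * t)) ^ ν := by
    rw [← Complex.exp_nat_mul, ← Complex.exp_add]
    congr 1
    push_cast
    ring
  rw [h2, neg_pow]
  push_cast
  ring

theorem fracDiff_trigSum {α : ℝ} (hα : 0 < α) (h : EuclideanSpace ℝ (Fin d)) (n : ℕ)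
    (c : (Fin d → ℤ) → ℂ) :
    fracDiff α h (trigSum n c) = trigSum n fun k => diffMult α (dot k h) * c k := by
  funext x
  rw [fracDiff]
  refine tsum_translate_trigSum c (fun k _ => ?_) x
  simp_rw [dot_smul]
  exact hasSum_diffMult hα _

/-- `(1 - z²)^α = (1 - z)^α (1 + z)^α` on the unit circle, as an identity of multipliers. -/
theorem diffMult_two_mul {α : ℝ} (hα : 0 < α) (t : ℝ) :
    diffMult α (2 * t) = (Complex.exp (Complex.I * (α * t : ℝ)) *
      (1 + Complex.exp (-(Complex.I * t))) ^ (α : ℂ)) * diffMult α t := by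
  set z := Complex.exp (-(Complex.I * t)) with hz
  have hzn : ‖z‖ = 1 := norm_exp_neg_I_mul t
  have h1 : Complex.exp (-(Complex.I * (2 * t : ℝ))) = z * z := by
    rw [hz, ← Complex.exp_add]
    congr 1
    push_cast
    ring
  have h2 : Complex.exp (Complex.I * (α * (2 * t) : ℝ))
      = Complex.exp (Complex.I * (α * t : ℝ)) * Complex.exp (Complex.I * (α * t : ℝ)) := by
    rw [← Complex.exp_add]
    congr 1
    push_cast
    ring
  have hα' : (α : ℂ) ≠ 0 := by exact_mod_cast hα.ne'
  have h3 : (1 + -(z * z)) ^ (α : ℂ) = (1 + z) ^ (α : ℂ) * (1 + -z) ^ (α : ℂ) := by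
    have e : 1 + -(z * z) = (1 + z) * (1 + -z) := by ring
    rw [e]
    by_cases ha : 1 + z = 0
    · simp [ha, hα']
    by_cases hb : 1 + -z = 0
    · simp [hb, hα']
    -- `1 + z` and `1 - z` have arguments in `(-π/2, π/2)`, so the principal power is multiplicative
    have hre : |z.re| ≤ 1 := hzn ▸ Complex.abs_re_le_norm z
    have hne : ∀ w : ℂ, w ≠ 0 → ‖1 - w‖ = 1 → 0 ≤ w.re → |w.arg| < Real.pi / 2 := by
      intro w hw hw1 hwre
      rw [Complex.abs_arg_lt_pi_div_two_iff]
      left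
      refine lt_of_le_of_ne hwre fun h0 => hw ?_
      have h4 := Complex.sq_norm (1 - w)
      rw [hw1, Complex.normSq_apply] at h4
      simp only [Complex.sub_re, Complex.sub_im, Complex.one_re, Complex.one_im, ← h0] at h4
      exact Complex.ext h0.symm (by simpa using by nlinarith)
    have ha' := hne (1 + z) ha (by simp [hzn]) (by
      simp only [Complex.add_re, Complex.one_re]; linarith [(abs_le.1 hre).1])
    have hb' := hne (1 + -z) hb (by simp [hzn]) (by
      simp only [Complex.add_re, Complex.one_re, Complex.neg_re]; linarith [(abs_le.1 hre).2])
    rw [abs_lt] at ha' hb'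
    have hlog : Complex.log ((1 + z) * (1 + -z)) = Complex.log (1 + z) + Complex.log (1 + -z) := by
      rw [Complex.log_mul_eq_add_log_iff ha hb]
      exact ⟨by linarith, by linarith⟩
    rw [Complex.cpow_def_of_ne_zero (mul_ne_zero ha hb), Complex.cpow_def_of_ne_zero ha,
      Complex.cpow_def_of_ne_zero hb, hlog, add_mul, Complex.exp_add]
  rw [diffMult, diffMult, h1, h2, h3]
  ring

/-- Doubling the step of a difference of a trigonometric polynomial. -/
theorem quasi_fracDiff_two_smul_le {p : ℝ≥0∞} (hp : 0 < p) {α : ℝ} (hα : 0 < α)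
    (h : EuclideanSpace ℝ (Fin d)) (n : ℕ) (c : (Fin d → ℤ) → ℂ) :
    quasi p (fracDiff α ((2 : ℝ) • h) (trigSum n c))
      ≤ binomSum p α * quasi p (fracDiff α h (trigSum n c)) := by
  rw [fracDiff_trigSum hα, fracDiff_trigSum hα]
  simp_rw [dot_smul, diffMult_two_mul hα, mul_assoc]
  have h1 := quasi_trigSum_le hp (n := n) (fun k => diffMult α (dot k h) * c k)
    (a := fun ν : ℕ => (binom α ν : ℂ)) (y := fun ν : ℕ => (α - ν) • h)
    (m := fun k => Complex.exp (Complex.I * (α * dot k h : ℝ)) *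
      (1 + Complex.exp (-(Complex.I * dot k h))) ^ (α : ℂ)) (fun k _ => ?_)
  · have e : ∑' ν : ℕ, ‖(binom α ν : ℂ)‖ₑ ^ subExp p = binomSum p α := by
      refine tsum_congr fun ν => ?_
      rw [← ofReal_norm, ← ofReal_norm, Complex.norm_real]
    rw [e] at h1
    simpa only [mul_assoc] using h1
  · have h2 := (hasSum_binom_mul_pow hα (z := Complex.exp (-(Complex.I * dot k h)))
      (norm_exp_neg_I_mul _).le).mul_left (Complex.exp (Complex.I * (α * dot k h : ℝ)))
    refine Eq.mp (congrArg (fun F : ℕ → ℂ => HasSum F _) (funext fun ν => ?_)) h2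
    have h3 : Complex.exp (Complex.I * dot k ((α - ν) • h))
        = Complex.exp (Complex.I * (α * dot k h : ℝ)) * Complex.exp (-(Complex.I * dot k h)) ^ ν := by
      rw [← Complex.exp_nat_mul, ← Complex.exp_add, dot_smul]
      congr 1
      push_cast
      ring
    rw [h3]
    ring

/-! ### Comparing differences and derivatives of trigonometric polynomials -/

section

open scoped SchwartzMap FourierTransform

/-- A function that is smooth near `0` coincides near `0` with a Fourier series whose coefficients
are in every `ℓ_q`. -/
theorem exists_fourier_series {φ : ℝ → ℂ} {δ : ℝ} (hδ : 0 < δ)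
    (hφ : ∀ t : ℝ, |t| < δ → ContDiffAt ℝ (⊤ : ℕ∞) φ t) :
    ∃ ε : ℝ, 0 < ε ∧ ∃ a : ℤ → ℂ, (∀ q : ℝ, 0 < q → ∑' j, ‖a j‖ₑ ^ q ≠ ∞) ∧
      ∀ t : ℝ, |t| ≤ ε → HasSum (fun j : ℤ => a j * Complex.exp (Complex.I * (j * t : ℝ))) (φ t) := by
  have hpi := Real.pi_gt_three
  have h2pi : 0 < 2 * Real.pi := Real.two_pi_pos
  set ε : ℝ := min (δ / 4) 1 with hε
  have hε0 : 0 < ε := lt_min (by linarith) one_pos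
  have hε1 : ε ≤ 1 := min_le_right _ _
  have hεδ : ε ≤ δ / 4 := min_le_left _ _
  let b : ContDiffBump (0 : ℝ) := ⟨ε / (2 * Real.pi), 2 * ε / (2 * Real.pi), by positivity, by
    gcongr; linarith⟩
  set ψ₀ : ℝ → ℂ := fun θ => (b θ : ℂ) * φ (2 * Real.pi * θ) with hψ₀
  have hout : ∀ θ : ℝ, 2 * ε ≤ |2 * Real.pi * θ| → b θ = 0 := by
    intro θ h
    apply b.zero_of_le_dist
    rw [abs_mul, abs_of_pos h2pi] at h
    simp only [b, dist_zero_right, Real.norm_eq_abs]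
    rw [div_le_iff₀ h2pi]
    linarith
  have hin : ∀ θ : ℝ, |2 * Real.pi * θ| ≤ ε → b θ = 1 := by
    intro θ h
    apply b.one_of_mem_closedBall
    rw [abs_mul, abs_of_pos h2pi] at h
    simp only [b, mem_closedBall_zero_iff, Real.norm_eq_abs]
    rw [le_div_iff₀ h2pi]
    linarith
  have hsmooth : ContDiff ℝ (⊤ : ℕ∞) ψ₀ := by
    rw [contDiff_iff_contDiffAt]
    intro θ
    rcases lt_or_ge |2 * Real.pi * θ| δ with h | h
    · refine ContDiffAt.mul ?_ ?_
      · exact (Complex.ofRealCLM.contDiff.comp b.contDiff).contDiffAt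
      · exact ContDiffAt.comp θ (hφ _ h) (contDiff_const.mul contDiff_id).contDiffAt
    · have : ψ₀ =ᶠ[nhds θ] fun _ => 0 := by
        have hop : IsOpen {θ : ℝ | 2 * ε < |2 * Real.pi * θ|} :=
          isOpen_lt continuous_const (by fun_prop)
        filter_upwards [hop.mem_nhds (by simp only [Set.mem_ofPred_eq]; linarith)] with y hy
        simp only [hψ₀]
        rw [hout y (le_of_lt hy)]
        simp
      exact contDiffAt_const.congr_of_eventuallyEq this
  have hsupp : HasCompactSupport ψ₀ := (hasCompactSupport_ofReal_comp b.hasCompactSupport).mul_right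
  set ψ : 𝓢(ℝ, ℂ) := hsupp.toSchwartzMap hsmooth with hψ
  have hψa : ∀ θ, ψ θ = (b θ : ℂ) * φ (2 * Real.pi * θ) := fun θ => rfl
  have ha : ∀ q : ℝ, 0 < q → ∑' j : ℤ, ‖𝓕 ψ j‖ₑ ^ q ≠ ∞ := by
    intro q hq
    obtain ⟨C, hC⟩ := exists_tsum_schwartz_le (𝓕 ψ) hq 0
    have h := hC 0 ⟨le_rfl, zero_le_one⟩
    rw [← (Equiv.neg ℤ).tsum_eq] at h
    refine ne_top_of_le_ne_top ENNReal.coe_ne_top (le_trans (le_of_eq ?_) h)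
    refine tsum_congr fun j => ?_
    simp
  refine ⟨ε, hε0, fun j => 𝓕 ψ j, ha, fun t ht => ?_⟩
  have hsum : Summable fun j : ℤ => 𝓕 ψ j * Complex.exp (Complex.I * (j * t : ℝ)) := by
    have h1 : Summable fun j : ℤ => ‖𝓕 ψ (j : ℝ)‖ := by
      have := ENNReal.summable_toReal (ha 1 one_pos)
      simpa using this
    refine Summable.of_norm (h1.congr fun j => ?_)
    rw [norm_mul, norm_exp_I_mul, mul_one]
  have hP := SchwartzMap.tsum_eq_tsum_fourier ψ (t / (2 * Real.pi))
  have hθ : 2 * Real.pi * (t / (2 * Real.pi)) = t := by field_simp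
  have hl : ∑' m : ℤ, ψ (t / (2 * Real.pi) + m) = φ t := by
    rw [tsum_eq_single 0]
    · rw [Int.cast_zero, add_zero, hψa, hθ, hin _ (by rwa [hθ])]
      simp
    · intro m hm
      rw [hψa, hout, Complex.ofReal_zero, zero_mul]
      rw [mul_add, hθ]
      have h1 : (1 : ℝ) ≤ |(m : ℝ)| := by exact_mod_cast Int.one_le_abs hm
      have h2 : |2 * Real.pi * m| = 2 * Real.pi * |(m : ℝ)| := by rw [abs_mul, abs_of_pos h2pi]
      have h3 := abs_sub_abs_le_abs_sub (2 * Real.pi * m) (-t)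
      rw [sub_neg_eq_add, abs_neg, add_comm, h2] at h3
      nlinarith
  have hr : ∑' j : ℤ, 𝓕 ψ j * fourier j ((t / (2 * Real.pi) : ℝ) : UnitAddCircle)
      = ∑' j : ℤ, 𝓕 ψ j * Complex.exp (Complex.I * (j * t : ℝ)) := by
    refine tsum_congr fun j => ?_
    rw [fourier_coe_apply]
    congr 2
    have hpi : (Real.pi : ℂ) ≠ 0 := by exact_mod_cast Real.pi_ne_zero
    push_cast
    field_simp
  have := hsum.hasSum
  rwa [← hr, ← hP, hl] at this

/-- The entire function `(1 - e^{-z}) / z`. -/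
def expQuot : ℂ → ℂ := dslope (fun z => 1 - Complex.exp (-z)) 0

theorem differentiable_expQuot : Differentiable ℂ expQuot := by
  have h : DifferentiableOn ℂ expQuot Set.univ :=
    (Complex.differentiableOn_dslope Filter.univ_mem).2 (by fun_prop)
  exact fun z => (h z (Set.mem_univ z)).differentiableAt Filter.univ_mem

theorem expQuot_zero : expQuot 0 = 1 := by
  rw [expQuot, dslope_same]
  have : HasDerivAt (fun z : ℂ => 1 - Complex.exp (-z)) 1 0 := by
    have h := ((hasDerivAt_neg (0 : ℂ)).cexp).const_sub 1
    simpa using h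
  exact this.deriv

theorem mul_expQuot (z : ℂ) : z * expQuot z = 1 - Complex.exp (-z) := by
  have := sub_smul_dslope (fun z : ℂ => 1 - Complex.exp (-z)) 0 z
  simpa [expQuot] using this

/-- The smooth factor of `diffMult` besides `(it)^α`. -/
def smoothMult (α t : ℝ) : ℂ :=
  Complex.exp (Complex.I * (α * t : ℝ)) * expQuot (Complex.I * t) ^ (α : ℂ)

/-- Near `0` the multiplier of `Δ_h^α` is `(it)^α` times a smooth nonvanishing function. -/
theorem exists_smoothMult (α : ℝ) (hα : 0 < α) : ∃ δ : ℝ, 0 < δ ∧ ∀ t : ℝ, |t| < δ →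
    ContDiffAt ℝ (⊤ : ℕ∞) (smoothMult α) t ∧ smoothMult α t ≠ 0 ∧
      diffMult α t = smoothMult α t * (Complex.I * t) ^ (α : ℂ) := by
  have hcont : Continuous fun t : ℝ => (expQuot (Complex.I * t)).re := by
    have := differentiable_expQuot.continuous
    fun_prop
  have hpos : ∀ᶠ t : ℝ in nhds (0 : ℝ), 0 < (expQuot (Complex.I * (t : ℂ))).re :=
    hcont.continuousAt.eventually (lt_mem_nhds (by simp [expQuot_zero]))
  obtain ⟨δ, hδ, hball⟩ := Metric.eventually_nhds_iff.1 hpos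
  refine ⟨δ, hδ, fun t ht => ?_⟩
  have hre : 0 < (expQuot (Complex.I * t)).re := hball (by simpa using ht)
  have hne : expQuot (Complex.I * t) ≠ 0 := fun h => by simp [h] at hre
  refine ⟨?_, ?_, ?_⟩
  · have h1 : ContDiffAt ℂ (⊤ : ℕ∞) (fun z => expQuot z ^ (α : ℂ)) (Complex.I * t) := by
      have ha : AnalyticAt ℂ expQuot (Complex.I * t) :=
        differentiable_expQuot.analyticAt _
      exact (ha.cpow analyticAt_const (Or.inl hre)).contDiffAt
    have h2 : ContDiff ℝ (⊤ : ℕ∞) fun t : ℝ => Complex.I * (t : ℂ) :=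
      contDiff_const.mul Complex.ofRealCLM.contDiff
    have h3 : ContDiff ℝ (⊤ : ℕ∞) fun t : ℝ => Complex.exp (Complex.I * (α * t : ℝ)) := by
      refine ContDiff.cexp (contDiff_const.mul ?_)
      exact Complex.ofRealCLM.contDiff.comp (contDiff_const.mul contDiff_id)
    have h4 : ContDiffAt ℝ (⊤ : ℕ∞) (fun t : ℝ => expQuot (Complex.I * t) ^ (α : ℂ)) t :=
      ContDiffAt.comp (g := fun z : ℂ => expQuot z ^ (α : ℂ)) (f := fun t : ℝ => Complex.I * (t : ℂ))
        t (h1.restrict_scalars ℝ) h2.contDiffAt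
    exact h3.contDiffAt.mul h4
  · exact mul_ne_zero (Complex.exp_ne_zero _) (by simp [Complex.cpow_eq_zero_iff, hne])
  · have hα' : (α : ℂ) ≠ 0 := by exact_mod_cast hα.ne'
    rw [diffMult, smoothMult, mul_assoc, ← sub_eq_add_neg, ← mul_expQuot]
    congr 1
    rcases eq_or_ne t 0 with rfl | ht0
    · simp [hα']
    have hIt : Complex.I * (t : ℂ) ≠ 0 := by simp [ht0]
    have harg : |(Complex.I * (t : ℂ)).arg| ≤ Real.pi / 2 := by
      rw [Complex.abs_arg_le_pi_div_two_iff]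
      simp
    have harg2 : |(expQuot (Complex.I * t)).arg| < Real.pi / 2 := by
      rw [Complex.abs_arg_lt_pi_div_two_iff]
      exact Or.inl hre
    rw [abs_le] at harg
    rw [abs_lt] at harg2
    -- the arguments add up to less than `π`, so the principal power is multiplicative here
    have hlog : Complex.log (Complex.I * t * expQuot (Complex.I * t))
        = Complex.log (Complex.I * t) + Complex.log (expQuot (Complex.I * t)) := by
      rw [Complex.log_mul_eq_add_log_iff hIt hne]
      exact ⟨by linarith, by linarith⟩
    rw [Complex.cpow_def_of_ne_zero (mul_ne_zero hIt hne), Complex.cpow_def_of_ne_zero hIt,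
      Complex.cpow_def_of_ne_zero hne, hlog, ← Complex.exp_add]
    congr 1
    ring

/-- For steps `h` such that `|(k, h)|` is small for all frequencies `k`, the difference and the
derivative of order `α` along `h` have comparable quasi-norms. -/
theorem exists_fracDiff_dirDeriv_le (d : ℕ) {p : ℝ≥0∞} (hp : 0 < p) {α : ℝ} (hα : 0 < α) :
    ∃ ε : ℝ, 0 < ε ∧ ∃ C : ℝ≥0, ∀ (n : ℕ) (c : (Fin d → ℤ) → ℂ) (h : EuclideanSpace ℝ (Fin d)),
      (∀ k ∈ freqBox d n, |dot k h| ≤ ε) →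
      quasi p (fracDiff α h (trigSum n c)) ≤ C * quasi p (dirDeriv α h (trigSum n c)) ∧
      quasi p (dirDeriv α h (trigSum n c)) ≤ C * quasi p (fracDiff α h (trigSum n c)) := by
  obtain ⟨δ, hδ, hm⟩ := exists_smoothMult α hα
  obtain ⟨ε₁, hε₁, a₁, ha₁, hs₁⟩ := exists_fourier_series hδ fun t ht => (hm t ht).1
  obtain ⟨ε₂, hε₂, a₂, ha₂, hs₂⟩ := exists_fourier_series (φ := fun t => (smoothMult α t)⁻¹) hδ
    fun t ht => (hm t ht).1.inv (hm t ht).2.1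
  have hq := subExp_pos hp
  set C₁ := ∑' j, ‖a₁ j‖ₑ ^ subExp p with hC₁
  set C₂ := ∑' j, ‖a₂ j‖ₑ ^ subExp p with hC₂
  refine ⟨min (δ / 2) (min ε₁ ε₂), by positivity, C₁.toNNReal + C₂.toNNReal, fun n c h hh => ?_⟩
  rw [ENNReal.coe_add, ENNReal.coe_toNNReal (ha₁ _ hq), ENNReal.coe_toNNReal (ha₂ _ hq)]
  have hd : ∀ k ∈ freqBox d n, |dot k h| < δ := fun k hk =>
    (hh k hk).trans_lt ((min_le_left _ _).trans_lt (by linarith))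
  have h₁ : ∀ k ∈ freqBox d n, |dot k h| ≤ ε₁ := fun k hk =>
    (hh k hk).trans ((min_le_right _ _).trans (min_le_left _ _))
  have h₂ : ∀ k ∈ freqBox d n, |dot k h| ≤ ε₂ := fun k hk =>
    (hh k hk).trans ((min_le_right _ _).trans (min_le_right _ _))
  have hcongr : ∀ c c' : (Fin d → ℤ) → ℂ, (∀ k ∈ freqBox d n, c k = c' k) →
      trigSum n c = trigSum n c' := fun c c' hcc => by
    funext x
    exact Finset.sum_congr rfl fun k hk => by rw [hcc k hk]
  rw [fracDiff_trigSum hα, dirDeriv_trigSum]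
  constructor
  · rw [hcongr _ (fun k => smoothMult α (dot k h) * ((Complex.I * (dot k h : ℂ)) ^ (α : ℂ) * c k))
      fun k hk => by rw [(hm _ (hd k hk)).2.2, mul_assoc]]
    refine (quasi_trigSum_le hp (fun k => (Complex.I * (dot k h : ℂ)) ^ (α : ℂ) * c k)
      (a := a₁) (y := fun j : ℤ => (j : ℝ) • h) (m := fun k => smoothMult α (dot k h))
      fun k hk => ?_).trans ?_
    · simp_rw [dot_smul]
      exact hs₁ _ (h₁ k hk)
    · gcongr
      exact le_self_add
  · rw [hcongr _ (fun k => (smoothMult α (dot k h))⁻¹ * (diffMult α (dot k h) * c k))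
      fun k hk => by
        rw [(hm _ (hd k hk)).2.2, mul_assoc, inv_mul_cancel_left₀ (hm _ (hd k hk)).2.1]]
    refine (quasi_trigSum_le hp (fun k => diffMult α (dot k h) * c k)
      (a := a₂) (y := fun j : ℤ => (j : ℝ) • h) (m := fun k => (smoothMult α (dot k h))⁻¹)
      fun k hk => ?_).trans ?_
    · simp_rw [dot_smul]
      exact hs₂ _ (h₂ k hk)
    · gcongr
      exact le_add_self

theorem dirDeriv_smul {α : ℝ} (hα : 0 < α) {c : ℝ} (hc : 0 ≤ c) (ξ : EuclideanSpace ℝ (Fin d))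
    (T : Torus d → ℂ) :
    dirDeriv α (c • ξ) T = fun x => ((c ^ α : ℝ) : ℂ) * dirDeriv α ξ T x := by
  have hα' : (α : ℂ) ≠ 0 := by exact_mod_cast hα.ne'
  have key : ∀ t : ℝ, (Complex.I * ((c * t : ℝ) : ℂ)) ^ (α : ℂ)
      = ((c ^ α : ℝ) : ℂ) * (Complex.I * (t : ℂ)) ^ (α : ℂ) := by
    intro t
    rcases hc.eq_or_lt with rfl | hc
    · simp [hα', Real.zero_rpow hα.ne']
    rcases eq_or_ne t 0 with rfl | ht
    · simp [hα']
    have hIt : Complex.I * (t : ℂ) ≠ 0 := by simp [ht]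
    have hcC : (c : ℂ) ≠ 0 := by exact_mod_cast hc.ne'
    have e : Complex.I * ((c * t : ℝ) : ℂ) = (c : ℂ) * (Complex.I * t) := by
      push_cast
      ring
    rw [e, Complex.cpow_def_of_ne_zero (mul_ne_zero hcC hIt), Complex.log_ofReal_mul hc hIt, add_mul,
      Complex.exp_add, Complex.cpow_def_of_ne_zero hIt, Complex.ofReal_cpow hc.le,
      Complex.cpow_def_of_ne_zero hcC, Complex.ofReal_log hc.le]
  funext x
  rw [dirDeriv, dirDeriv, ← tsum_mul_left]
  refine tsum_congr fun k => ?_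
  have h1 := dot_smul k c ξ
  rw [dot, dot] at h1
  rw [h1, key]
  ring

theorem quasi_dirDeriv_smul {p : ℝ≥0∞} (hp : 0 < p) {α : ℝ} (hα : 0 < α) {c : ℝ} (hc : 0 ≤ c)
    (ξ : EuclideanSpace ℝ (Fin d)) (T : Torus d → ℂ) :
    quasi p (dirDeriv α (c • ξ) T)
      = ENNReal.ofReal (c ^ α) ^ subExp p * quasi p (dirDeriv α ξ T) := by
  rw [dirDeriv_smul hα hc, quasi_const_mul hp, ← ofReal_norm, Complex.norm_real,
    Real.norm_of_nonneg (by positivity)]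

theorem abs_dot_le {n : ℕ} {k : Fin d → ℤ} (hk : k ∈ freqBox d n) (h : EuclideanSpace ℝ (Fin d)) :
    |dot k h| ≤ d * (n * ‖h‖) := by
  rw [dot]
  refine (Finset.abs_sum_le_sum_abs _ _).trans ?_
  refine (Finset.sum_le_card_nsmul _ _ (n * ‖h‖) fun j _ => ?_).trans (by simp)
  rw [abs_mul]
  have h1 : |(k j : ℝ)| ≤ n := by exact_mod_cast mem_freqBox.1 hk j
  have h2 : |h j| ≤ ‖h‖ := by simpa using PiLp.norm_apply_le h j
  gcongr

end

/-! ### Differences of fractional order of functions in `L_p` -/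

/-- The coefficient `(-1)^ν binom(α,ν)` of the difference of order `α`. -/
def fracCoef (α : ℝ) (ν : ℕ) : ℂ := (((-1) ^ ν * binom α ν : ℝ) : ℂ)

theorem enorm_fracCoef (α : ℝ) (ν : ℕ) : ‖fracCoef α ν‖ₑ = ‖binom α ν‖ₑ := by
  rw [fracCoef, ← ofReal_norm, Complex.norm_real, ofReal_norm, enorm_mul]
  simp

theorem fracDiff_eq (α : ℝ) (h : EuclideanSpace ℝ (Fin d)) (f : Torus d → ℂ) :
    fracDiff α h f = fun x => ∑' ν, fracCoef α ν * f (x + Torus.mk ((α - ν) • h)) := rfl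

theorem tsum_enorm_fracCoef (p : ℝ≥0∞) (α : ℝ) :
    ∑' ν, ‖fracCoef α ν‖ₑ ^ subExp p = binomSum p α := by
  simp_rw [enorm_fracCoef]
  rfl

theorem quasi_fracDiff_le {p : ℝ≥0∞} (hp : 0 < p) (α : ℝ) (h : EuclideanSpace ℝ (Fin d))
    {f : Torus d → ℂ} (hf : AEStronglyMeasurable f volume) :
    quasi p (fracDiff α h f) ≤ binomSum p α * quasi p f := by
  rw [fracDiff_eq, ← tsum_enorm_fracCoef]
  exact quasi_tsum_translate_le hp hf _ _

theorem aesm_fracDiff (α : ℝ) (h : EuclideanSpace ℝ (Fin d)) {f : Torus d → ℂ}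
    (hf : AEStronglyMeasurable f volume) : AEStronglyMeasurable (fracDiff α h f) volume := by
  rw [fracDiff_eq]
  refine AEMeasurable.aestronglyMeasurable ?_
  exact AEMeasurable.tsum fun ν => ((aesm_translate hf _).const_mul _).aemeasurable

theorem ae_summable_fracDiff {p : ℝ≥0∞} (hp : 0 < p) {α : ℝ} (hα : Admissible p α)
    (h : EuclideanSpace ℝ (Fin d)) {f : Torus d → ℂ} (hf : MemLp f p volume) :
    ∀ᵐ x, Summable fun ν : ℕ => fracCoef α ν * f (x + Torus.mk ((α - ν) • h)) := by
  refine ae_summable_translate hp hf _ ?_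
  rw [tsum_enorm_fracCoef]
  exact hα.binomSum_ne_top hp

theorem fracDiff_sub_ae {p : ℝ≥0∞} (hp : 0 < p) {α : ℝ} (hα : Admissible p α)
    (h : EuclideanSpace ℝ (Fin d)) {f g : Torus d → ℂ} (hf : MemLp f p volume)
    (hg : MemLp g p volume) :
    fracDiff α h (f - g) =ᵐ[volume] fracDiff α h f - fracDiff α h g := by
  filter_upwards [ae_summable_fracDiff hp hα h hf, ae_summable_fracDiff hp hα h hg] with x h1 h2
  rw [fracDiff_eq, fracDiff_eq, fracDiff_eq, Pi.sub_apply, ← h1.tsum_sub h2]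
  refine tsum_congr fun ν => ?_
  rw [Pi.sub_apply, mul_sub]

theorem tsum_prod_eq_tsum_antidiagonal {F : ℕ × ℕ → ℂ} (hF : Summable F) :
    ∑' i, F i = ∑' k, ∑ i ∈ Finset.HasAntidiagonal.antidiagonal k, F i := by
  have hF' := (Finset.HasAntidiagonal.sigmaAntidiagonalEquivProd (A := ℕ)).summable_iff.2 hF
  rw [← (Finset.HasAntidiagonal.sigmaAntidiagonalEquivProd (A := ℕ)).tsum_eq]
  refine hF'.tsum_sigma.trans (tsum_congr fun k => ?_)
  rw [tsum_fintype, Finset.univ_eq_attach]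
  exact Finset.sum_attach _ F

/-- Differences of admissible orders compose additively; the coefficients combine by Vandermonde's
identity. -/
theorem fracDiff_comp_ae {p : ℝ≥0∞} (hp : 0 < p) {α γ : ℝ} (hα : Admissible p α)
    (hγ : Admissible p γ) (h : EuclideanSpace ℝ (Fin d)) {f : Torus d → ℂ}
    (hf : MemLp f p volume) :
    fracDiff γ h (fracDiff α h f) =ᵐ[volume] fracDiff (γ + α) h f := by
  -- the double series of translates has coefficients in `ℓ_q`, hence may be rearranged almost everywhere
  have hs : ∑' i : ℕ × ℕ, ‖fracCoef γ i.1 * fracCoef α i.2‖ₑ ^ subExp p ≠ ∞ := by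
    have e : ∀ i : ℕ × ℕ, ‖fracCoef γ i.1 * fracCoef α i.2‖ₑ ^ subExp p
        = ‖fracCoef γ i.1‖ₑ ^ subExp p * ‖fracCoef α i.2‖ₑ ^ subExp p := fun i => by
      rw [enorm_mul, ENNReal.mul_rpow_of_nonneg _ _ (subExp_pos hp).le]
    simp_rw [e]
    rw [ENNReal.tsum_prod']
    simp_rw [ENNReal.tsum_mul_left, ENNReal.tsum_mul_right, tsum_enorm_fracCoef]
    exact ENNReal.mul_ne_top (hγ.binomSum_ne_top hp) (hα.binomSum_ne_top hp)
  filter_upwards [ae_summable_translate hp hf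
    (fun i : ℕ × ℕ => Torus.mk ((γ - i.1) • h + (α - i.2) • h)) hs] with x hx
  have h1 : fracDiff γ h (fracDiff α h f) x
      = ∑' i : ℕ × ℕ, fracCoef γ i.1 * fracCoef α i.2 *
        f (x + Torus.mk ((γ - i.1) • h + (α - i.2) • h)) := by
    rw [hx.tsum_prod, fracDiff_eq]
    refine tsum_congr fun μ => ?_
    rw [fracDiff_eq, ← tsum_mul_left]
    refine tsum_congr fun ν => ?_
    rw [mk_add, add_assoc, mul_assoc]
  rw [h1, tsum_prod_eq_tsum_antidiagonal hx, fracDiff_eq]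
  refine tsum_congr fun k => ?_
  have h2 : fracCoef (γ + α) k
      = ∑ i ∈ Finset.HasAntidiagonal.antidiagonal k, fracCoef γ i.1 * fracCoef α i.2 := by
    rw [fracCoef, binom_add, Finset.mul_sum, Complex.ofReal_sum]
    refine Finset.sum_congr rfl fun i hi => ?_
    rw [fracCoef, fracCoef, ← Complex.ofReal_mul, ← Finset.HasAntidiagonal.mem_antidiagonal.1 hi, pow_add]
    congr 1
    ring
  rw [h2, Finset.sum_mul]
  refine Finset.sum_congr rfl fun i hi => ?_
  have hk : ((k : ℕ) : ℝ) = i.1 + i.2 := by exact_mod_cast (Finset.HasAntidiagonal.mem_antidiagonal.1 hi).symm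
  rw [← add_smul, hk]
  congr 5
  ring

theorem mk_single (i : Fin d) (t : ℝ) : Torus.mk (EuclideanSpace.single i t) = axis i t := by
  funext j
  rw [Torus.mk, axis]
  rcases eq_or_ne j i with rfl | hj
  · simp
  · simp [hj]

theorem mk_nsmul (k : ℕ) (v : EuclideanSpace ℝ (Fin d)) :
    Torus.mk ((k : ℝ) • v) = k • Torus.mk v := by
  funext j
  simp [Torus.mk]

theorem fracDiff_natCast (r : ℕ) (h : EuclideanSpace ℝ (Fin d)) (f : Torus d → ℂ) :
    fracDiff (r : ℝ) h f = (fwdDiff (Torus.mk h))^[r] f := by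
  funext x
  rw [fwdDiff_iter_eq_sum_shift, fracDiff, tsum_eq_sum (s := Finset.range (r + 1)),
    ← Finset.sum_range_reflect]
  · refine Finset.sum_congr rfl fun k hk => ?_
    have hk' : k ≤ r := Nat.lt_succ_iff.1 (Finset.mem_range.1 hk)
    rw [binom_natCast, show r + 1 - 1 - k = r - k by omega, Nat.choose_symm hk', ← mk_nsmul,
      Nat.cast_sub hk', sub_sub_cancel]
    simp
  · intro ν hν
    rw [binom_natCast, Nat.choose_eq_zero_of_lt (by simpa using hν)]
    simp

/-- The axis differences of a sufficiently large integer order are controlled by the differences of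
order `α`. -/
theorem exists_axisBound (d : ℕ) {p : ℝ≥0∞} (hp : 0 < p) {α : ℝ} (hα : Admissible p α) :
    ∃ r : ℕ, 1 ≤ r ∧ ∃ C : ℝ≥0, ∀ (f : Torus d → ℂ) (s : ℝ), MemLp f p volume →
      AxisBound p r s (C * modulus p α f s ^ subExp p) f := by
  -- `r - α` is again admissible, by the second alternative
  obtain ⟨r, hr⟩ := exists_nat_gt (α + max (p⁻¹.toReal - 1) 0)
  have hα0 := hα.pos
  have h0 : 0 ≤ max (p⁻¹.toReal - 1) 0 := le_max_right _ _
  have hr1 : 1 ≤ r := by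
    have : (0 : ℝ) < r := by linarith
    exact_mod_cast this
  have hγ : Admissible p (r - α) := Or.inr (by linarith)
  refine ⟨r, hr1, (binomSum p (r - α)).toNNReal, fun f s hf i t ht => ?_⟩
  rw [ENNReal.coe_toNNReal (hγ.binomSum_ne_top hp), ← mk_single, ← fracDiff_natCast]
  have h1 := fracDiff_comp_ae hp hα hγ (EuclideanSpace.single i t) hf
  rw [sub_add_cancel] at h1
  rw [← quasi_congr_ae h1]
  refine (quasi_fracDiff_le hp _ _ (aesm_fracDiff _ _ hf.1)).trans ?_
  gcongr
  refine ENNReal.rpow_le_rpow ?_ (subExp_pos hp).le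
  exact le_iSup₂_of_le (EuclideanSpace.single i t) (by simpa using ht) le_rfl

/-! ### Comparison of the modulus with the realization -/

theorem le_of_rpow_le_mul_rpow {q : ℝ} (hq : 0 < q) {C : ℝ≥0} {a b : ℝ≥0∞}
    (h : a ^ q ≤ C * b ^ q) : a ≤ (C ^ q⁻¹ : ℝ≥0) * b := by
  rw [← ENNReal.rpow_le_rpow_iff hq, ENNReal.mul_rpow_of_nonneg _ _ hq.le,
    ← ENNReal.coe_rpow_of_nonneg _ hq.le, NNReal.rpow_inv_rpow hq.ne']
  exact h

theorem le_of_rpow_le_mul_add_rpow {q : ℝ} (hq : 0 < q) {C : ℝ≥0} {a b c : ℝ≥0∞}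
    (h : a ^ q ≤ C * (b ^ q + c ^ q)) : a ≤ ((C * 2) ^ q⁻¹ : ℝ≥0) * (b + c) := by
  refine le_of_rpow_le_mul_rpow hq (h.trans ?_)
  rw [ENNReal.coe_mul, mul_assoc, ENNReal.coe_ofNat, two_mul]
  gcongr
  · exact le_self_add
  · exact le_add_self

theorem modulus_mono (p : ℝ≥0∞) (α : ℝ) (f : Torus d → ℂ) {s δ : ℝ} (h : s ≤ δ) :
    modulus p α f s ≤ modulus p α f δ :=
  iSup₂_le fun v hv => le_iSup₂_of_le v (hv.trans h) le_rfl

theorem quasi_fracDiff_le_modulus (p : ℝ≥0∞) (hp : 0 < p) (α : ℝ) (f : Torus d → ℂ) {δ : ℝ}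
    {h : EuclideanSpace ℝ (Fin d)} (hh : ‖h‖ ≤ δ) :
    quasi p (fracDiff α h f) ≤ modulus p α f δ ^ subExp p :=
  ENNReal.rpow_le_rpow (le_iSup₂_of_le h hh le_rfl) (subExp_pos hp).le

theorem one_le_floor_inv {δ : ℝ} (hδ : 0 < δ) (hδ1 : δ < 1) : 1 ≤ ⌊1 / δ⌋₊ := by
  rw [Nat.one_le_floor_iff, le_div_iff₀ hδ]
  linarith

theorem floor_inv_mul_le {δ : ℝ} (hδ : 0 < δ) : ⌊1 / δ⌋₊ * δ ≤ 1 := by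
  rw [← le_div_iff₀ hδ]
  exact Nat.floor_le (by positivity)

theorem gridStep_floor_inv_le {δ : ℝ} (hδ : 0 < δ) (hδ1 : δ < 1) : gridStep ⌊1 / δ⌋₊ ≤ δ := by
  have hn : (1 : ℝ) ≤ ⌊1 / δ⌋₊ := by exact_mod_cast one_le_floor_inv hδ hδ1
  have h1 : 1 < (⌊1 / δ⌋₊ + 1) * δ := by
    rw [← div_lt_iff₀ hδ]
    exact Nat.lt_floor_add_one _
  rw [gridStep, div_le_iff₀ (by positivity)]
  nlinarith [Real.pi_le_four]

/-- Jackson's inequality for the modulus of fractional order. -/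
theorem exists_jackson_modulus (d : ℕ) {p : ℝ≥0∞} (hp : 0 < p) {α : ℝ} (hα : Admissible p α) :
    ∃ C : ℝ≥0, ∀ (f : Torus d → ℂ) (δ : ℝ), MemLp f p volume → 0 < δ → δ < 1 →
      ∃ T ∈ trigPoly d ⌊1 / δ⌋₊, eLpNorm (f - T) p volume ≤ C * modulus p α f δ := by
  obtain ⟨r, hr, C₁, hC₁⟩ := exists_axisBound d hp hα
  obtain ⟨C₂, hC₂⟩ := exists_jackson d hp hr
  refine ⟨(C₂ * C₁) ^ (subExp p)⁻¹, fun f δ hf hδ hδ1 => ?_⟩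
  obtain ⟨T, hT, hfT⟩ := hC₂ f _ _ (one_le_floor_inv hδ hδ1) hf (hC₁ f _ hf)
  refine ⟨T, hT, le_of_rpow_le_mul_rpow (subExp_pos hp) (hfT.trans ?_)⟩
  rw [ENNReal.coe_mul, mul_assoc]
  gcongr
  · exact (subExp_pos hp).le
  · exact modulus_mono p α f (gridStep_floor_inv_le hδ hδ1)

theorem quasi_fracDiff_two_pow_smul_le {p : ℝ≥0∞} (hp : 0 < p) {α : ℝ} (hα : 0 < α)
    (h : EuclideanSpace ℝ (Fin d)) (n : ℕ) (c : (Fin d → ℤ) → ℂ) (m : ℕ) :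
    quasi p (fracDiff α ((2 : ℝ) ^ m • h) (trigSum n c))
      ≤ binomSum p α ^ m * quasi p (fracDiff α h (trigSum n c)) := by
  induction m with
  | zero => simp
  | succ m ih =>
    rw [pow_succ', mul_smul, pow_succ', mul_assoc]
    refine (quasi_fracDiff_two_smul_le hp hα _ n c).trans ?_
    gcongr

/-- `sup_{|ξ| = 1} ‖(∂/∂ξ)^α T‖_p`. -/
def dirDerivSup (p : ℝ≥0∞) (α : ℝ) (T : Torus d → ℂ) : ℝ≥0∞ :=
  ⨆ (ξ : EuclideanSpace ℝ (Fin d)) (_ : ‖ξ‖ = 1), eLpNorm (dirDeriv α ξ T) p volume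

theorem realizationTerm_eq (p : ℝ≥0∞) (α : ℝ) (f : Torus d → ℂ) (δ : ℝ) (T : Torus d → ℂ) :
    realizationTerm p α f δ T
      = eLpNorm (f - T) p volume + ENNReal.ofReal (δ ^ α) * dirDerivSup p α T := rfl

theorem quasi_dirDeriv_le {p : ℝ≥0∞} (hp : 0 < p) {α : ℝ} (hα : 0 < α) {δ : ℝ}
    {v : EuclideanSpace ℝ (Fin d)} (hv : ‖v‖ ≤ δ) (T : Torus d → ℂ) :
    quasi p (dirDeriv α v T) ≤ (ENNReal.ofReal (δ ^ α) * dirDerivSup p α T) ^ subExp p := by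
  have hq := subExp_pos hp
  rcases eq_or_ne v 0 with rfl | hv0
  · have h := quasi_dirDeriv_smul hp hα le_rfl (0 : EuclideanSpace ℝ (Fin d)) T
    rw [smul_zero, Real.zero_rpow hα.ne', ENNReal.ofReal_zero, ENNReal.zero_rpow_of_pos hq,
      zero_mul] at h
    rw [h]
    exact zero_le
  · have h1 : ‖v‖ • (‖v‖⁻¹ • v) = v := smul_inv_smul₀ (norm_ne_zero_iff.2 hv0) v
    have h2 : ‖‖v‖⁻¹ • v‖ = 1 := norm_smul_inv_norm (𝕜 := ℝ) hv0
    rw [← h1, quasi_dirDeriv_smul hp hα (norm_nonneg v), quasi,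
      ← ENNReal.mul_rpow_of_nonneg _ _ hq.le]
    refine ENNReal.rpow_le_rpow (mul_le_mul' ?_ ?_) hq.le
    · exact ENNReal.ofReal_le_ofReal (Real.rpow_le_rpow (norm_nonneg v) hv hα.le)
    · exact le_iSup₂_of_le (‖v‖⁻¹ • v) h2 le_rfl

theorem memLp_of_mem_trigPoly (p : ℝ≥0∞) {n : ℕ} {T : Torus d → ℂ} (hT : T ∈ trigPoly d n) :
    MemLp T p volume := by
  obtain ⟨c, rfl⟩ := exists_eq_trigSum hT
  exact memLp_trigSum p n c

/-- The upper estimate: the differences of `f - T` are bounded trivially, and those of `T` by its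
derivatives after halving the step until `|(k, h)|` is small for all frequencies. -/
theorem exists_modulus_le (d : ℕ) {p : ℝ≥0∞} (hp : 0 < p) {α : ℝ} (hα : Admissible p α) :
    ∃ C : ℝ≥0, ∀ (f : Torus d → ℂ) (δ : ℝ), MemLp f p volume → 0 < δ →
      ∀ T ∈ trigPoly d ⌊1 / δ⌋₊, modulus p α f δ ≤ C * realizationTerm p α f δ T := by
  have hα0 := hα.pos
  obtain ⟨ε, hε, C₀, hC₀⟩ := exists_fracDiff_dirDeriv_le d hp hα0
  -- frequencies satisfy `|(k, h)| ≤ d n δ ≤ d`, so `m` halvings of `h` bring `(k, h)` below `ε`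
  obtain ⟨m, hm⟩ := pow_unbounded_of_one_lt (d / ε) (one_lt_two : (1 : ℝ) < 2)
  set B := binomSum p α with hB
  have hBt : B ≠ ∞ := hα.binomSum_ne_top hp
  refine ⟨((B.toNNReal + B.toNNReal ^ m * C₀) * 2) ^ (subExp p)⁻¹,
    fun f δ hf hδ T hT => iSup₂_le fun h hh => ?_⟩
  rw [realizationTerm_eq]
  refine le_of_rpow_le_mul_add_rpow (subExp_pos hp) ?_
  rw [ENNReal.coe_add, ENNReal.coe_mul, ENNReal.coe_pow, ENNReal.coe_toNNReal hBt]
  have hTp := memLp_of_mem_trigPoly p hT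
  have h1 : fracDiff α h f =ᵐ[volume] fracDiff α h (f - T) + fracDiff α h T := by
    filter_upwards [fracDiff_sub_ae hp hα h hf hTp] with x hx
    rw [Pi.add_apply, hx, Pi.sub_apply, sub_add_cancel]
  have h2 : quasi p (fracDiff α h f) ≤ B * quasi p (f - T) + quasi p (fracDiff α h T) := by
    rw [quasi_congr_ae h1]
    refine (quasi_add_le hp (aesm_fracDiff _ _ (hf.sub hTp).1) (aesm_fracDiff _ _ hTp.1)).trans ?_
    gcongr
    exact quasi_fracDiff_le hp α h (hf.sub hTp).1
  have h3 : quasi p (fracDiff α h T)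
      ≤ B ^ m * C₀ * (ENNReal.ofReal (δ ^ α) * dirDerivSup p α T) ^ subExp p := by
    obtain ⟨c, rfl⟩ := exists_eq_trigSum hT
    set v : EuclideanSpace ℝ (Fin d) := ((2 : ℝ) ^ m)⁻¹ • h with hv
    have hvh : (2 : ℝ) ^ m • v = h := smul_inv_smul₀ (by positivity) h
    have hvn : ‖v‖ = ‖h‖ / 2 ^ m := by
      rw [hv, norm_smul, Real.norm_of_nonneg (by positivity), div_eq_inv_mul]
    have h4 : ∀ k ∈ freqBox d ⌊1 / δ⌋₊, |dot k v| ≤ ε := fun k hk => by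
      refine (abs_dot_le hk v).trans ?_
      have h5 : ⌊1 / δ⌋₊ * ‖h‖ ≤ 1 :=
        (mul_le_mul_of_nonneg_left hh (Nat.cast_nonneg _)).trans (floor_inv_mul_le hδ)
      have h6 : (d : ℝ) ≤ 2 ^ m * ε := by
        rw [div_lt_iff₀ hε] at hm
        exact hm.le
      rw [hvn, ← mul_div_assoc, ← mul_div_assoc, div_le_iff₀ (by positivity)]
      calc (d : ℝ) * (⌊1 / δ⌋₊ * ‖h‖) ≤ d * 1 := by gcongr
        _ ≤ ε * 2 ^ m := by linarith
    have h7 : ‖v‖ ≤ δ := by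
      rw [hvn]
      exact (div_le_self (norm_nonneg h) (one_le_pow₀ one_le_two)).trans hh
    rw [← hvh]
    refine (quasi_fracDiff_two_pow_smul_le hp hα0 v _ c m).trans ?_
    rw [mul_assoc]
    gcongr
    exact (hC₀ _ c v h4).1.trans (by gcongr; exact quasi_dirDeriv_le hp hα0 h7 _)
  refine h2.trans ((add_le_add_right h3 _).trans ?_)
  rw [add_mul, mul_add, mul_add]
  exact add_le_add le_self_add le_add_self

/-- The derivatives of a trigonometric polynomial are controlled by its distance from `f` and the
modulus of `f`. -/
theorem exists_realizationTerm_le (d : ℕ) (hd : 1 ≤ d) {p : ℝ≥0∞} (hp : 0 < p) {α : ℝ}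
    (hα : Admissible p α) :
    ∃ C : ℝ≥0, ∀ (f : Torus d → ℂ) (δ : ℝ), MemLp f p volume → 0 < δ →
      ∀ T ∈ trigPoly d ⌊1 / δ⌋₊,
        realizationTerm p α f δ T ≤ C * (eLpNorm (f - T) p volume + modulus p α f δ) := by
  have hα0 := hα.pos
  have hq := subExp_pos hp
  obtain ⟨ε, hε, C₀, hC₀⟩ := exists_fracDiff_dirDeriv_le d hp hα0
  set B := binomSum p α with hB
  have hBt : B ≠ ∞ := hα.binomSum_ne_top hp
  have hd0 : (0 : ℝ) < d := by exact_mod_cast hd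
  -- the step `h = cδξ` has `|h| ≤ δ` and `|(k, h)| ≤ c d n δ ≤ ε`
  set c := min 1 (ε / d) with hc
  have hc0 : 0 < c := by positivity
  set M : ℝ≥0 := (c⁻¹ ^ α).toNNReal ^ subExp p * (C₀ * (1 + B.toNNReal)) with hM
  refine ⟨1 + (M * 2) ^ (subExp p)⁻¹, fun f δ hf hδ T hT => ?_⟩
  have hTp := memLp_of_mem_trigPoly p hT
  have key : ENNReal.ofReal (δ ^ α) * dirDerivSup p α T
      ≤ ((M * 2) ^ (subExp p)⁻¹ : ℝ≥0) * (eLpNorm (f - T) p volume + modulus p α f δ) := by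
    rw [dirDerivSup, ENNReal.mul_iSup]
    refine iSup_le fun ξ => ?_
    rw [ENNReal.mul_iSup]
    refine iSup_le fun hξ => ?_
    refine le_of_rpow_le_mul_add_rpow hq ?_
    rw [ENNReal.mul_rpow_of_nonneg _ _ hq.le]
    change _ * quasi p (dirDeriv α ξ T) ≤ M * (quasi p (f - T) + _)
    rw [← quasi_dirDeriv_smul hp hα0 hδ.le]
    have h1 : c⁻¹ • (c • (δ • ξ)) = δ • ξ := inv_smul_smul₀ hc0.ne' _
    rw [← h1, quasi_dirDeriv_smul hp hα0 (by positivity), hM, ENNReal.coe_mul,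
      ENNReal.coe_rpow_of_nonneg _ hq.le, ENNReal.ofReal, mul_assoc]
    gcongr
    have hn : ‖c • δ • ξ‖ = c * δ := by
      rw [norm_smul, norm_smul, hξ, mul_one, Real.norm_of_nonneg hc0.le, Real.norm_of_nonneg hδ.le]
    set h := c • δ • ξ with hh
    have hle : ‖h‖ ≤ δ := by
      rw [hn]
      exact mul_le_of_le_one_left hδ.le (min_le_left _ _)
    have hdot : ∀ k ∈ freqBox d ⌊1 / δ⌋₊, |dot k h| ≤ ε := fun k hk => by
      refine (abs_dot_le hk h).trans ?_
      have h5 := floor_inv_mul_le hδ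
      have h6 : d * c ≤ ε := by
        rw [mul_comm, ← le_div_iff₀ hd0]
        exact min_le_right _ _
      calc (d : ℝ) * (⌊1 / δ⌋₊ * ‖h‖) = (d * c) * (⌊1 / δ⌋₊ * δ) := by rw [hn]; ring
        _ ≤ (d * c) * 1 := by gcongr
        _ ≤ ε := by linarith
    have h2 : fracDiff α h T =ᵐ[volume] fracDiff α h f - fracDiff α h (f - T) := by
      filter_upwards [fracDiff_sub_ae hp hα h hf hTp] with x hx
      rw [Pi.sub_apply, hx, Pi.sub_apply, sub_sub_cancel]
    have h3 : quasi p (fracDiff α h T) ≤ modulus p α f δ ^ subExp p + B * quasi p (f - T) := by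
      rw [quasi_congr_ae h2]
      exact (quasi_sub_le hp (aesm_fracDiff _ _ hf.1) (aesm_fracDiff _ _ (hf.sub hTp).1)).trans
        (add_le_add (quasi_fracDiff_le_modulus p hp α f hle)
          (quasi_fracDiff_le hp α h (hf.sub hTp).1))
    have h4 : quasi p (dirDeriv α h T) ≤ C₀ * quasi p (fracDiff α h T) := by
      obtain ⟨c, rfl⟩ := exists_eq_trigSum hT
      exact (hC₀ _ c h hdot).2
    refine h4.trans ?_
    rw [ENNReal.coe_mul, mul_assoc, ENNReal.coe_add, ENNReal.coe_one, ENNReal.coe_toNNReal hBt]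
    gcongr
    refine h3.trans ?_
    rw [mul_add, add_comm]
    gcongr
    · exact le_add_self
    · exact le_mul_of_one_le_left' le_self_add
  rw [realizationTerm_eq, ENNReal.coe_add, ENNReal.coe_one, add_mul, one_mul]
  exact add_le_add le_self_add key

end Realization

end

theorem theorem4p1 (d : ℕ) (hd : 1 ≤ d) (p : ℝ≥0∞) (hp : 0 < p) (α : ℝ)
    (hα : Realization.Admissible p α) :
    (∃ C : ℝ≥0, 0 < C ∧
      ∀ f : Realization.Torus d → ℂ, MemLp f p volume → ∀ δ : ℝ, 0 < δ → δ < 1 →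
        Realization.modulus p α f δ ≤ C * Realization.realization p α f δ ∧
        Realization.realization p α f δ ≤ C * Realization.modulus p α f δ) ∧
    (∀ K : ℝ≥0, ∃ C : ℝ≥0, 0 < C ∧
      ∀ f : Realization.Torus d → ℂ, MemLp f p volume → ∀ δ : ℝ, 0 < δ → δ < 1 →
        ∀ T ∈ Realization.trigPoly d ⌊1 / δ⌋₊,
          eLpNorm (f - T) p volume ≤ K * Realization.bestApprox p ⌊1 / δ⌋₊ f →
          Realization.modulus p α f δ ≤ C * Realization.realizationTerm p α f δ T ∧
          Realization.realizationTerm p α f δ T ≤ C * Realization.modulus p α f δ) := by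
  obtain ⟨C₁, h₁⟩ := Realization.exists_modulus_le d hp hα
  obtain ⟨C₂, h₂⟩ := Realization.exists_realizationTerm_le d hd hp hα
  obtain ⟨C₃, h₃⟩ := Realization.exists_jackson_modulus d hp hα
  -- If `‖f - T‖` is at most `L` times the modulus, so is the realization term up to a constant.
  have hlow : ∀ (L : ℝ≥0) (f : Realization.Torus d → ℂ) (δ : ℝ), MemLp f p volume → 0 < δ →
      ∀ T ∈ Realization.trigPoly d ⌊1 / δ⌋₊,
      eLpNorm (f - T) p volume ≤ L * Realization.modulus p α f δ →
      Realization.realizationTerm p α f δ T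
        ≤ (C₂ * (L + 1) : ℝ≥0) * Realization.modulus p α f δ := by
    intro L f δ hf hδ T hT hL
    refine (h₂ f δ hf hδ T hT).trans ?_
    rw [ENNReal.coe_mul, mul_assoc, ENNReal.coe_add, ENNReal.coe_one, add_mul, one_mul]
    gcongr
  refine ⟨⟨C₁ + C₂ * (C₃ + 1) + 1, by positivity, fun f hf δ hδ hδ1 => ⟨?_, ?_⟩⟩,
    fun K => ⟨C₁ + C₂ * (K * C₃ + 1) + 1, by positivity, fun f hf δ hδ hδ1 T hT hfT => ⟨?_, ?_⟩⟩⟩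
  · have hne : ((C₁ + C₂ * (C₃ + 1) + 1 : ℝ≥0) : ℝ≥0∞) ≠ 0 := by
      rw [ENNReal.coe_ne_zero]
      positivity
    rw [Realization.realization, ENNReal.mul_iInf_of_ne hne ENNReal.coe_ne_top]
    refine le_iInf fun T => ?_
    rw [ENNReal.mul_iInf_of_ne hne ENNReal.coe_ne_top]
    refine le_iInf fun hT => (h₁ f δ hf hδ T hT).trans ?_
    gcongr
    rw [add_assoc]
    exact le_self_add
  · obtain ⟨T, hT, hfT⟩ := h₃ f δ hf hδ hδ1
    refine (iInf₂_le T hT).trans ((hlow C₃ f δ hf hδ T hT hfT).trans ?_)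
    gcongr
    exact le_add_self.trans le_self_add
  · refine (h₁ f δ hf hδ T hT).trans ?_
    gcongr
    rw [add_assoc]
    exact le_self_add
  · obtain ⟨T', hT', hfT'⟩ := h₃ f δ hf hδ hδ1
    have hL : eLpNorm (f - T) p volume ≤ (K * C₃ : ℝ≥0) * Realization.modulus p α f δ := by
      refine hfT.trans ?_
      rw [ENNReal.coe_mul, mul_assoc]
      gcongr
      exact (iInf₂_le T' hT').trans hfT'
    refine (hlow (K * C₃) f δ hf hδ T hT hL).trans ?_
    gcongr
    exact le_add_self.trans le_self_add
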